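/- Let $0\le j<k<n$ be integers. Write $G_{n,k}$ for the Grassmannian of $k$-dimensional linear subspaces of $\mathbb R^n$, and parametrize an affine $k$-plane $\tau=\xi+u$ of $\mathbb R^n$ by the pair $(\xi,u)$ with $\xi\in G_{n,k}$, $u\in\xi^\perp$. Let $\mathcal G_{n,k}$ be the space of all affine $k$-planes, equipped with the measure $d\tau=d\xi\,du$, where $d\xi$ is the $O(n)$-invariant probability measure on $G_{n,k}$ and $du$ is the volume element on $\xi^\perp$; let $|\tau|$ be the Euclidean distance from $\tau$ to the origin. Use the same notation with $j$ in place of $k$ (so $\mathcal G_{n,0}=\mathbb R^n$). For $1\le p\le\infty$ and $\nu\in\mathbb R$, let $L^p_\nu(\mathcal G_{n,k})$ be the space of (classes of) measurable scalar functions $f$ on $\mathcal G_{n,k}$ (real-valued or complex-valued) with $\|f\|_{p,\nu}=\big\|\,|\tau|^\nu f\,\big\|_{L^p(\mathcal G_{n,k})}<\infty$. The $j$-plane to $k$-plane transform of a function $f$ on $\mathcal G_{n,j}$ is $$(R_{j,k}f)(\xi,u)=\int d_\xi\eta\int_{\eta^\perp\cap\xi} f(\eta,y+u)\,dy ,\qquad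 (\xi,u)\in\mathcal G_{n,k},$$ where $\eta$ runs over the $j$-dimensional linear subspaces of $\xi$ and $d_\xi\eta$ is the rotation-invariant probability measure on them. Put $\sigma_{m-1}=2\pi^{m/2}/\Gamma(m/2)$, the area of the unit sphere in $\mathbb R^m$. **Theorem.** Let $1\le p\le\infty$, $1/p+1/p'=1$, $\nu=\mu-(k-j)/p'$ and $\mu>k-n/p-j/p'$. Then for every $f\in L^p_\mu(\mathcal G_{n,j})$ the integral $(R_{j,k}f)(\tau)$ converges absolutely for almost every $\tau\in\mathcal G_{n,k}$, and $R_{j,k}$ is a bounded linear operator from $L^p_\mu(\mathcal G_{n,j})$ to $L^p_\nu(\mathcal G_{n,k})$, with operator norm $$\|R_{j,k}\|=\pi^{(k-j)/2}\left(\frac{\sigma_{n-k-1}}{\sigma_{n-j-1}}\right)^{1/p}\frac{\Gamma\big((\mu+n/p-k+j/p')/2\big)}{\Gamma\big((\mu+n/p-j/p)/2\big)} .$$ -/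

import Mathlib

open MeasureTheory
open scoped ENNReal

set_option linter.unusedSectionVars false

noncomputable section

namespace KPlane

/-- The Grassmannian of `k`-dimensional linear subspaces of `V`. -/
@[ext]
structure Gr (V : Type*) [NormedAddCommGroup V] [InnerProductSpace ℝ V] (k : ℕ) where
  /-- The underlying linear subspace. -/
  carrier : Submodule ℝ V
  finrank_carrier : Module.finrank ℝ carrier = k

section Defs

variable {V : Type*} [NormedAddCommGroup V] [InnerProductSpace ℝ V] [FiniteDimensional ℝ V]

/-- The usual topology of the Grassmannian, given by identifying a subspace with the orthogonal
projection onto it. -/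
instance (k : ℕ) : TopologicalSpace (Gr V k) :=
  TopologicalSpace.induced (fun ξ : Gr V k => ξ.carrier.starProjection) inferInstance

/-- The Borel sigma-algebra of the Grassmannian. -/
instance (k : ℕ) : MeasurableSpace (Gr V k) := borel _

instance (k : ℕ) : BorelSpace (Gr V k) := ⟨rfl⟩

lemma Gr.isEmbedding (k : ℕ) :
    Topology.IsEmbedding (fun ξ : Gr V k => ξ.carrier.starProjection) :=
  ⟨⟨rfl⟩, fun _ _ h => Gr.ext (Submodule.starProjection_inj.1 h)⟩

instance (k : ℕ) : T2Space (Gr V k) := (Gr.isEmbedding k).t2Space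

instance (k : ℕ) : SecondCountableTopology (Gr V k) :=
  (Gr.isEmbedding k).secondCountableTopology

variable [CompleteSpace V]

/-- The orthogonal group `O(V)` is compact. -/
instance : CompactSpace (unitary (V →L[ℝ] V)) := by
  refine isCompact_iff_compactSpace.1 (?_ : IsCompact (unitary (V →L[ℝ] V) : Set (V →L[ℝ] V)))
  refine Metric.isCompact_of_isClosed_isBounded ?_ ?_
  · have : (unitary (V →L[ℝ] V) : Set (V →L[ℝ] V)) = {x | star x * x = 1} ∩ {x | x * star x = 1} := by
      ext x; simp [Unitary.mem_iff]
    rw [this]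
    exact (isClosed_eq (by fun_prop) (by fun_prop)).inter (isClosed_eq (by fun_prop) (by fun_prop))
  · refine (Metric.isBounded_closedBall (x := (0 : V →L[ℝ] V)) (r := 1)).subset fun x hx => ?_
    rw [mem_closedBall_zero_iff]
    exact ContinuousLinearMap.opNorm_le_bound _ zero_le_one fun v => by
      rw [one_mul]; exact (Unitary.norm_map (⟨x, hx⟩ : unitary (V →L[ℝ] V)) v).le

/-- The action of the orthogonal group `O(V)` on the Grassmannian, `ξ ↦ g ξ`. -/
def Gr.rotate {k : ℕ} (g : unitary (V →L[ℝ] V)) (ξ : Gr V k) : Gr V k :=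
  ⟨ξ.carrier.map (Unitary.linearIsometryEquiv g).toLinearEquiv.toLinearMap,
    (LinearEquiv.finrank_map_eq (Unitary.linearIsometryEquiv g).toLinearEquiv ξ.carrier).trans ξ.finrank_carrier⟩

open Classical in
/-- The `O(V)`-invariant probability measure on the Grassmannian: the image of the normalized
Haar measure of the compact group `O(V)` under an orbit map `g ↦ g ξ₀`. -/
def Gr.invariantMeasure (V : Type*) [NormedAddCommGroup V] [InnerProductSpace ℝ V]
    [FiniteDimensional ℝ V] [CompleteSpace V] (k : ℕ) : Measure (Gr V k) :=
  if h : Nonempty (Gr V k) then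
    (Measure.haarMeasure (⊤ : TopologicalSpace.PositiveCompacts (unitary (V →L[ℝ] V)))).map
      (fun g => Gr.rotate g h.some)
  else 0

lemma Gr.continuous_rotate {k : ℕ} (ξ : Gr V k) :
    Continuous (fun g : unitary (V →L[ℝ] V) => Gr.rotate g ξ) := by
  rw [(Gr.isEmbedding k).continuous_iff]
  have : ((fun ξ : Gr V k => ξ.carrier.starProjection) ∘ fun g => Gr.rotate g ξ) =
      fun g : unitary (V →L[ℝ] V) => (g : V →L[ℝ] V) * ξ.carrier.starProjection * star (g : V →L[ℝ] V) := by
    funext g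
    ext x
    exact Submodule.starProjection_map_apply (Unitary.linearIsometryEquiv g) ξ.carrier x
  rw [this]
  fun_prop

lemma Gr.surjective_rotate {k : ℕ} (ξ : Gr V k) :
    Function.Surjective (fun g : unitary (V →L[ℝ] V) => Gr.rotate g ξ) := by
  intro η
  let e : ξ.carrier ≃ₗᵢ[ℝ] η.carrier := (stdOrthonormalBasis ℝ ξ.carrier).equiv (stdOrthonormalBasis ℝ η.carrier)
    (finCongr (ξ.finrank_carrier.trans η.finrank_carrier.symm))
  let L : ξ.carrier →ₗᵢ[ℝ] V := η.carrier.subtypeₗᵢ.comp e.toLinearIsometry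
  let F : V ≃ₗᵢ[ℝ] V := L.extend.toLinearIsometryEquiv rfl
  refine ⟨Unitary.linearIsometryEquiv.symm F, Gr.ext ?_⟩
  refine Submodule.eq_of_le_of_finrank_eq ?_ ((Gr.rotate _ ξ).finrank_carrier.trans η.finrank_carrier.symm)
  rintro _ ⟨x, hx, rfl⟩
  have : L.extend x = L ⟨x, hx⟩ := L.extend_apply ⟨x, hx⟩
  change L.extend x ∈ η.carrier
  rw [this]
  exact (e ⟨x, hx⟩).2

instance (k : ℕ) [Nonempty (Gr V k)] : IsProbabilityMeasure (Gr.invariantMeasure V k) := by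
  rename_i h
  rw [Gr.invariantMeasure, dif_pos h]
  have : IsProbabilityMeasure
      (Measure.haarMeasure (⊤ : TopologicalSpace.PositiveCompacts (unitary (V →L[ℝ] V)))) :=
    ⟨by simpa using Measure.haarMeasure_self (K₀ := (⊤ : TopologicalSpace.PositiveCompacts (unitary (V →L[ℝ] V))))⟩
  exact Measure.isProbabilityMeasure_map (Gr.continuous_rotate _).measurable.aemeasurable

lemma Gr.map_rotate_invariantMeasure (k : ℕ) (g : unitary (V →L[ℝ] V)) :
    (Gr.invariantMeasure V k).map (Gr.rotate g) = Gr.invariantMeasure V k := by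
  by_cases h : Nonempty (Gr V k)
  swap
  · simp [Gr.invariantMeasure, h]
  have hc : Measurable (Gr.rotate g : Gr V k → Gr V k) := by
    refine Continuous.measurable ((Gr.isEmbedding k).continuous_iff.2 ?_)
    have : ((fun ξ : Gr V k => ξ.carrier.starProjection) ∘ Gr.rotate g) = fun ξ : Gr V k =>
        (g : V →L[ℝ] V) * ξ.carrier.starProjection * star (g : V →L[ℝ] V) := by
      funext ξ
      ext x
      exact Submodule.starProjection_map_apply (Unitary.linearIsometryEquiv g) ξ.carrier x
    rw [this]
    have := (Gr.isEmbedding (V := V) k).continuous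
    fun_prop
  rw [Gr.invariantMeasure, dif_pos h, Measure.map_map hc (Gr.continuous_rotate _).measurable]
  conv_rhs => rw [← map_mul_left_eq_self
    (Measure.haarMeasure (⊤ : TopologicalSpace.PositiveCompacts (unitary (V →L[ℝ] V)))) g,
    Measure.map_map (Gr.continuous_rotate _).measurable (measurable_const_mul g)]
  congr 1
  funext g'
  refine Gr.ext ?_
  exact (Submodule.map_comp (Unitary.linearIsometryEquiv g').toLinearEquiv.toLinearMap
    (Unitary.linearIsometryEquiv g).toLinearEquiv.toLinearMap h.some.carrier).symm

/-- The space of affine `k`-planes of `V`. A `k`-plane `τ = ξ + u` is parametrized by the pair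
`(ξ, u)` of its direction `ξ` and its point `u ∈ ξᗮ` nearest to the origin. -/
@[ext]
structure AffGr (V : Type*) [NormedAddCommGroup V] [InnerProductSpace ℝ V] (k : ℕ) where
  /-- The direction `ξ` of the plane `τ = ξ + u`. -/
  gr : Gr V k
  /-- The point `u` of the plane `τ = ξ + u`. -/
  foot : V
  foot_mem : foot ∈ gr.carrierᗮ

/-- The direction `ξ` of the plane `τ = ξ + u`, as a linear subspace. -/
abbrev AffGr.dir {k : ℕ} (τ : AffGr V k) : Submodule ℝ V := τ.gr.carrier

/-- The plane `ξ + u` as an affine subspace of `V`. -/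
def AffGr.toAffineSubspace {k : ℕ} (τ : AffGr V k) : AffineSubspace ℝ V :=
  AffineSubspace.mk' τ.foot τ.dir

/-- `|τ|`, the distance from the plane `τ` to the origin. -/
def AffGr.absDist {k : ℕ} (τ : AffGr V k) : ℝ :=
  Metric.infDist 0 (τ.toAffineSubspace : Set V)

lemma AffGr.toAffineSubspace_injective (k : ℕ) :
    Function.Injective (AffGr.toAffineSubspace : AffGr V k → AffineSubspace ℝ V) := by
  intro σ τ h
  have hd : σ.dir = τ.dir := by
    simpa [AffGr.toAffineSubspace] using congrArg AffineSubspace.direction h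
  have hm : σ.foot ∈ τ.toAffineSubspace := h ▸ AffineSubspace.self_mem_mk' _ _
  have hm' : σ.foot - τ.foot ∈ τ.dir := by
    simpa [AffGr.toAffineSubspace, AffineSubspace.mem_mk'] using hm
  have ho : σ.foot - τ.foot ∈ τ.dirᗮ := Submodule.sub_mem _ (hd ▸ σ.foot_mem) τ.foot_mem
  have hz : σ.foot - τ.foot = 0 := by
    simpa using (Submodule.mem_orthogonal _ _).1 ho _ hm'
  exact AffGr.ext (Gr.ext hd) (sub_eq_zero.1 hz)

lemma AffGr.exists_toAffineSubspace_eq {k : ℕ} {A : AffineSubspace ℝ V} (hA : (A : Set V).Nonempty)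
    (hk : Module.finrank ℝ A.direction = k) : ∃ τ : AffGr V k, τ.toAffineSubspace = A := by
  obtain ⟨a, ha⟩ := hA
  refine ⟨⟨⟨A.direction, hk⟩, a - A.direction.starProjection a,
    Submodule.sub_starProjection_mem_orthogonal a⟩, ?_⟩
  have h : a - A.direction.starProjection a ∈ A := by
    have := AffineSubspace.vadd_mem_of_mem_direction
      (A.direction.neg_mem (A.direction.starProjection_apply_mem a)) ha
    rwa [vadd_eq_add, neg_add_eq_sub] at this
  exact AffineSubspace.mk'_eq h

lemma AffGr.absDist_eq {k : ℕ} (τ : AffGr V k) : τ.absDist = ‖τ.foot‖ := by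
  have hne : (τ.toAffineSubspace : Set V).Nonempty := ⟨_, AffineSubspace.self_mem_mk' _ _⟩
  refine le_antisymm ?_ ((Metric.le_infDist hne).2 fun x hx => ?_)
  · have := Metric.infDist_le_dist_of_mem (x := 0)
      (show τ.foot ∈ (τ.toAffineSubspace : Set V) from AffineSubspace.self_mem_mk' _ _)
    simpa [AffGr.absDist] using this
  · have hx' : x - τ.foot ∈ τ.dir := by
      simpa [AffGr.toAffineSubspace, AffineSubspace.mem_mk'] using hx
    have h0 : inner ℝ (x - τ.foot) τ.foot = 0 := (Submodule.mem_orthogonal _ _).1 τ.foot_mem _ hx'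
    have := norm_add_sq_eq_norm_sq_add_norm_sq_real h0
    rw [sub_add_cancel] at this
    rw [dist_zero_left]
    exact abs_le_of_sq_le_sq' (by nlinarith [norm_nonneg (x - τ.foot)]) (norm_nonneg x) |>.2

variable [MeasurableSpace V] [BorelSpace V]

/-- The Borel sigma-algebra of the space of `k`-planes, regarded as a set of pairs `(ξ, u)`. -/
instance (k : ℕ) : MeasurableSpace (AffGr V k) :=
  MeasurableSpace.comap (fun τ : AffGr V k => (τ.gr, τ.foot)) inferInstance

/-- The volume measure `du` of `ξᗮ`, regarded as a measure on the `k`-planes with direction `ξ`. -/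
def AffGr.fiberMeasure {k : ℕ} (ξ : Gr V k) : Measure (AffGr V k) :=
  (volume : Measure ξ.carrierᗮ).map fun u : ξ.carrierᗮ => ⟨ξ, (u : V), u.2⟩

/-- The measure `dτ = dξ du` on the space of affine `k`-planes. -/
def AffGr.measure (V : Type*) [NormedAddCommGroup V] [InnerProductSpace ℝ V]
    [FiniteDimensional ℝ V] [CompleteSpace V] [MeasurableSpace V] [BorelSpace V] (k : ℕ) :
    Measure (AffGr V k) :=
  (Gr.invariantMeasure V k).bind AffGr.fiberMeasure

lemma AffGr.measurable_mk {k : ℕ} (ξ : Gr V k) :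
    Measurable (fun u : ξ.carrierᗮ => (⟨ξ, (u : V), u.2⟩ : AffGr V k)) :=
  measurable_comap_iff.2 (measurable_const.prodMk measurable_subtype_coe)

lemma AffGr.measurable_fiberMeasure (k : ℕ) :
    Measurable (AffGr.fiberMeasure : Gr V k → Measure (AffGr V k)) := by
  by_cases h : Nonempty (Gr V k)
  swap
  · have := not_nonempty_iff.1 h
    exact measurable_of_empty _
  obtain ⟨ξ⟩ := h
  refine ((Gr.continuous_rotate ξ).measurable.measurable_comp_iff_of_surjective
    (Gr.surjective_rotate ξ)).1 (Measure.measurable_of_measurable_coe _ fun s hs => ?_)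
  have hort : ∀ (g : unitary (V →L[ℝ] V)) (u : ξ.carrierᗮ),
      (g : V →L[ℝ] V) u ∈ (Gr.rotate g ξ).carrierᗮ := by
    intro g u
    rw [Submodule.mem_orthogonal]
    rintro _ ⟨x, hx, rfl⟩
    exact (Unitary.inner_map_map g x u).trans ((Submodule.mem_orthogonal _ _).1 u.2 x hx)
  let Φ : unitary (V →L[ℝ] V) × ξ.carrierᗮ → AffGr V k := fun q =>
    ⟨Gr.rotate q.1 ξ, (q.1 : V →L[ℝ] V) q.2, hort q.1 q.2⟩
  have hΦ : Measurable Φ := by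
    refine measurable_comap_iff.2 (Measurable.prodMk ?_ ?_)
    · exact (Gr.continuous_rotate ξ).measurable.comp measurable_fst
    · refine Continuous.measurable ?_
      exact (continuous_subtype_val.comp continuous_fst).clm_apply
        (continuous_subtype_val.comp continuous_snd)
  have key : ∀ g : unitary (V →L[ℝ] V), AffGr.fiberMeasure (Gr.rotate g ξ) s =
      (volume : Measure ξ.carrierᗮ) (Prod.mk g ⁻¹' (Φ ⁻¹' s)) := by
    intro g
    let L : ξ.carrierᗮ →ₗᵢ[ℝ] (Gr.rotate g ξ).carrierᗮ :=
      { toFun := fun u => ⟨(g : V →L[ℝ] V) u, hort g u⟩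
        map_add' := fun u v => Subtype.ext (by simp)
        map_smul' := fun c u => Subtype.ext (by simp)
        norm_map' := fun u => Unitary.norm_map g u }
    have hfr : Module.finrank ℝ ξ.carrierᗮ = Module.finrank ℝ (Gr.rotate g ξ).carrierᗮ := by
      have h1 := ξ.carrier.finrank_add_finrank_orthogonal
      have h2 := (Gr.rotate g ξ).carrier.finrank_add_finrank_orthogonal
      have h3 := ξ.finrank_carrier
      have h4 := (Gr.rotate g ξ).finrank_carrier
      omega
    let e := L.toLinearIsometryEquiv hfr
    rw [AffGr.fiberMeasure, Measure.map_apply (AffGr.measurable_mk _) hs,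
      ← e.measurePreserving.map_eq,
      Measure.map_apply e.continuous.measurable (AffGr.measurable_mk _ hs)]
    rfl
  simp_rw [Function.comp_apply, key]
  exact measurable_measure_prodMk_left (hΦ hs)

theorem AffGr.lintegral_measure (k : ℕ) {φ : AffGr V k → ℝ≥0∞} (hφ : Measurable φ) :
    ∫⁻ τ, φ τ ∂AffGr.measure V k =
      ∫⁻ ξ, (∫⁻ u : ξ.carrierᗮ, φ ⟨ξ, (u : V), u.2⟩) ∂Gr.invariantMeasure V k := by
  rw [AffGr.measure, Measure.lintegral_bind (AffGr.measurable_fiberMeasure k).aemeasurable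
    hφ.aemeasurable]
  exact lintegral_congr fun ξ => lintegral_map hφ (AffGr.measurable_mk ξ)

/-- For a `k`-plane `τ = ξ + u`, the `j`-plane `ζ + u ⊂ τ` of `V`, where `ζ` is a `j`-plane of the
Euclidean space `ξ`; if `ζ = (η, y)`, with `y` in the orthogonal complement of `η` in `ξ`, then
this is the plane `(η, y + u)`. -/
def AffGr.within {j k : ℕ} (τ : AffGr V k) (ζ : AffGr τ.dir j) : AffGr V j :=
  ⟨⟨ζ.dir.map τ.dir.subtype,
      (Submodule.finrank_map_subtype_eq _ _).trans ζ.gr.finrank_carrier⟩,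
    (ζ.foot : V) + τ.foot, by
    rw [Submodule.mem_orthogonal]
    rintro _ ⟨x, hx, rfl⟩
    have h1 : inner ℝ (x : V) (ζ.foot : V) = 0 := (Submodule.mem_orthogonal _ _).1 ζ.foot_mem x hx
    have h2 : inner ℝ (x : V) τ.foot = 0 := (Submodule.mem_orthogonal _ _).1 τ.foot_mem x x.2
    simp [inner_add_right, h1, h2]⟩

/-- The integral defining `(R_{j,k} f)(τ)` converges absolutely. -/
def TransformConverges {𝕜 : Type*} [RCLike 𝕜] {j k : ℕ} (f : AffGr V j → 𝕜) (τ : AffGr V k) :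
    Prop :=
  Integrable (fun ζ : AffGr τ.dir j => f (τ.within ζ)) (AffGr.measure τ.dir j)

/-- The `j`-plane to `k`-plane transform: for `τ = ξ + u`, the integral of `f` over all `j`-planes
contained in `τ`, that is
`(R_{j,k} f)(ξ, u) = ∫ d_ξη ∫_{ηᗮ ∩ ξ} f (η, y + u) dy`,
where `d_ξη` is the invariant probability measure on the `j`-dimensional subspaces of `ξ`. -/
def transform {𝕜 : Type*} [RCLike 𝕜] {j : ℕ} (k : ℕ) (f : AffGr V j → 𝕜) (τ : AffGr V k) : 𝕜 :=
  ∫ ζ : AffGr τ.dir j, f (τ.within ζ) ∂AffGr.measure τ.dir j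

/-- The weighted norm `‖f‖_{p,ν} = ‖ |τ|^ν f ‖_p`. -/
def wNorm {𝕜 : Type*} [RCLike 𝕜] {k : ℕ} (p : ℝ≥0∞) (ν : ℝ) (f : AffGr V k → 𝕜) : ℝ≥0∞ :=
  eLpNorm (fun τ => ((τ.absDist ^ ν : ℝ) : 𝕜) * f τ) p (AffGr.measure V k)

/-- Membership of `f` in the weighted space `L^p_ν` of functions on affine `k`-planes:
`f` is measurable and `‖f‖_{p,ν} < ∞`. -/
def MemWLp {𝕜 : Type*} [RCLike 𝕜] {k : ℕ} (p : ℝ≥0∞) (ν : ℝ) (f : AffGr V k → 𝕜) : Prop :=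
  AEStronglyMeasurable f (AffGr.measure V k) ∧ wNorm p ν f < ∞

end Defs

/-- `σ_m = 2 π^((m+1)/2) / Γ((m+1)/2)`, the area of the unit sphere `S^m` in `ℝ^(m+1)`. -/
def sphereArea (m : ℕ) : ℝ :=
  2 * Real.pi ^ (((m : ℝ) + 1) / 2) / Real.Gamma (((m : ℝ) + 1) / 2)

end KPlane

end

/-! The transform commutes with rotations and lowers the degree of a power by `k - j`: by Pythagoras
and a Gaussian integral, `|σ|^(-l)` goes to `betaConst (k - j) l` times `|τ|^(k-j-l)`
(`lTransform_rpow`). The decisive exponent is `l = μ + (n - j)/p`, for which `|σ|^(-l)` just fails,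
logarithmically, to lie in `L^p_μ` when `p` is finite. The hypothesis on `μ` says exactly that `k -
j < l`, the condition for its transform to converge.

Upper bound: Hölder's inequality on each `τ`, with the weight for which `|σ|^(-l)` gives equality
(`lTransform_rpow_le`), bounds `(R F)^p` by a power of `|τ|` times the transform of a weighted
`F^p`. That transform is integrated exactly by the identity `lintegral_rpow_absDist_mul_lTransform`:
averaging over rotations reduces the identity to radial functions, where it is a change of
variables. The identity contributes the same constant `betaConst (k - j) l`, together with the ratio
of sphere areas; the former factors combine to its `p`-th power. For `p = ∞` a pointwise comparison
with `|σ|^(-l)` replaces both steps. The identity also shows that null sets of `j`-planes are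
invisible to almost every `τ`.

Sharpness: for finite `p`, powers `|σ|^(-l-ε)` cut off to `|σ| > 1` are nearly extremal. The norms
of the function and of its transform blow up at the same rate, and their quotient is bounded below
by a quantity tending to the constant as `ε → 0`. For `p = ∞` the cut-off power with `ε = 0` already
suffices. -/

noncomputable section

namespace KPlane

/-! ### Haar measure of the orthogonal group -/

section Group

variable (V : Type*) [NormedAddCommGroup V] [InnerProductSpace ℝ V] [FiniteDimensional ℝ V]
  [CompleteSpace V]

/-- The normalized Haar measure of the orthogonal group. -/
def haarO : Measure (unitary (V →L[ℝ] V)) :=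
  Measure.haarMeasure (⊤ : TopologicalSpace.PositiveCompacts (unitary (V →L[ℝ] V)))

instance : (haarO V).IsHaarMeasure := by unfold haarO; infer_instance

instance : IsProbabilityMeasure (haarO V) := ⟨by
  simpa [haarO] using Measure.haarMeasure_self
    (K₀ := (⊤ : TopologicalSpace.PositiveCompacts (unitary (V →L[ℝ] V))))⟩

/-- A compact group is unimodular: a right translate of the Haar probability measure is again one,
and there is only one. -/
instance : (haarO V).IsMulRightInvariant where
  map_mul_right_eq_self g := by
    have : IsProbabilityMeasure ((haarO V).map (· * g)) :=
      Measure.isProbabilityMeasure_map (measurable_mul_const g).aemeasurable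
    have : ((haarO V).map (· * g)).IsHaarMeasure := inferInstance
    exact Measure.isHaarMeasure_eq_of_isProbabilityMeasure _ _

end Group

/-! ### Isometries acting on planes; uniqueness of the invariant measure -/

section Map

variable {V W : Type*} [NormedAddCommGroup V] [InnerProductSpace ℝ V] [FiniteDimensional ℝ V]
  [NormedAddCommGroup W] [InnerProductSpace ℝ W] [FiniteDimensional ℝ W]

/-- The image of a subspace under an isometric isomorphism. -/
def Gr.map {k : ℕ} (e : V ≃ₗᵢ[ℝ] W) (ξ : Gr V k) : Gr W k :=
  ⟨ξ.carrier.map e.toLinearEquiv.toLinearMap,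
    (LinearEquiv.finrank_map_eq e.toLinearEquiv ξ.carrier).trans ξ.finrank_carrier⟩

lemma Gr.map_orthogonal {k : ℕ} (e : V ≃ₗᵢ[ℝ] W) (ξ : Gr V k) {u : V} (hu : u ∈ ξ.carrierᗮ) :
    e u ∈ (Gr.map e ξ).carrierᗮ := by
  rw [Submodule.mem_orthogonal]
  rintro _ ⟨x, hx, rfl⟩
  exact (e.inner_map_map x u).trans ((Submodule.mem_orthogonal _ _).1 hu x hx)

/-- The image of an affine plane under an isometric isomorphism. -/
def AffGr.map {k : ℕ} (e : V ≃ₗᵢ[ℝ] W) (τ : AffGr V k) : AffGr W k :=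
  ⟨Gr.map e τ.gr, e τ.foot, Gr.map_orthogonal e τ.gr τ.foot_mem⟩

lemma Gr.continuous_map {k : ℕ} (e : V ≃ₗᵢ[ℝ] W) : Continuous (Gr.map e : Gr V k → Gr W k) := by
  rw [(Gr.isEmbedding k).continuous_iff]
  have : ((fun ξ : Gr W k => ξ.carrier.starProjection) ∘ Gr.map e) = fun ξ : Gr V k =>
      ((e : V ≃L[ℝ] W) : V →L[ℝ] W) ∘L ξ.carrier.starProjection ∘L
        ((e.symm : W ≃L[ℝ] V) : W →L[ℝ] V) := by
    funext ξ
    ext x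
    exact Submodule.starProjection_map_apply e ξ.carrier x
  rw [this]
  have := (Gr.isEmbedding (V := V) k).continuous
  exact continuous_const.clm_comp (this.clm_comp continuous_const)

lemma Gr.continuous_rotate_uncurry {k : ℕ} :
    Continuous (fun q : unitary (V →L[ℝ] V) × Gr V k => Gr.rotate q.1 q.2) := by
  rw [(Gr.isEmbedding k).continuous_iff]
  have : ((fun ξ : Gr V k => ξ.carrier.starProjection) ∘
      fun q : unitary (V →L[ℝ] V) × Gr V k => Gr.rotate q.1 q.2) = fun q =>
      (q.1 : V →L[ℝ] V) * q.2.carrier.starProjection * star (q.1 : V →L[ℝ] V) := by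
    funext q
    ext x
    exact Submodule.starProjection_map_apply (Unitary.linearIsometryEquiv q.1) q.2.carrier x
  rw [this]
  have h1 : Continuous fun q : unitary (V →L[ℝ] V) × Gr V k => q.2.carrier.starProjection :=
    (Gr.isEmbedding (V := V) k).continuous.comp continuous_snd
  have h2 : Continuous fun q : unitary (V →L[ℝ] V) × Gr V k => (q.1 : V →L[ℝ] V) :=
    continuous_subtype_val.comp continuous_fst
  exact (h2.mul h1).mul h2.star

lemma Gr.rotate_mul {k : ℕ} (g h : unitary (V →L[ℝ] V)) (ξ : Gr V k) :
    Gr.rotate (g * h) ξ = Gr.rotate g (Gr.rotate h ξ) :=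
  Gr.ext (Submodule.map_comp (Unitary.linearIsometryEquiv h).toLinearEquiv.toLinearMap
    (Unitary.linearIsometryEquiv g).toLinearEquiv.toLinearMap ξ.carrier)

/-- The action of the orthogonal group on affine planes. -/
def AffGr.rotate {k : ℕ} (g : unitary (V →L[ℝ] V)) (τ : AffGr V k) : AffGr V k :=
  AffGr.map (Unitary.linearIsometryEquiv g) τ

lemma AffGr.rotate_mul {k : ℕ} (g h : unitary (V →L[ℝ] V)) (τ : AffGr V k) :
    AffGr.rotate (g * h) τ = AffGr.rotate g (AffGr.rotate h τ) :=
  AffGr.ext (Gr.rotate_mul g h τ.gr) rfl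

@[simp] lemma AffGr.absDist_map {k : ℕ} (e : V ≃ₗᵢ[ℝ] W) (τ : AffGr V k) :
    (τ.map e).absDist = τ.absDist := by
  rw [AffGr.absDist_eq, AffGr.absDist_eq]
  exact e.norm_map _

@[simp] lemma AffGr.absDist_rotate {k : ℕ} (g : unitary (V →L[ℝ] V)) (τ : AffGr V k) :
    (AffGr.rotate g τ).absDist = τ.absDist := AffGr.absDist_map _ _

/-- After a rotation aligning the directions, the feet have equal norm and their difference is
orthogonal to the common direction. The reflection exchanging the feet therefore fixes that
direction pointwise. -/
lemma AffGr.exists_rotate_eq {k : ℕ} {σ τ : AffGr V k} (h : σ.absDist = τ.absDist) :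
    ∃ g : unitary (V →L[ℝ] V), AffGr.rotate g σ = τ := by
  obtain ⟨g, hg⟩ := Gr.surjective_rotate σ.gr τ.gr
  have hg' : Gr.rotate g σ.gr = τ.gr := hg
  set σ' := AffGr.rotate g σ
  have hgr : σ'.gr = τ.gr := hg
  have hn : ‖σ'.foot‖ = ‖τ.foot‖ := by
    rw [← AffGr.absDist_eq, ← AffGr.absDist_eq, ← h]; exact AffGr.absDist_rotate g σ
  let R := (ℝ ∙ (σ'.foot - τ.foot))ᗮ.reflection
  have hfix : ∀ x ∈ τ.gr.carrier, R x = x := by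
    intro x hx
    refine Submodule.reflection_mem_subspace_eq_self (Submodule.mem_orthogonal_singleton_iff_inner_right.2 ?_)
    have hm : σ'.foot - τ.foot ∈ τ.gr.carrierᗮ :=
      Submodule.sub_mem _ (hgr ▸ σ'.foot_mem) τ.foot_mem
    rw [real_inner_comm]
    exact (Submodule.mem_orthogonal _ _).1 hm x hx
  refine ⟨Unitary.linearIsometryEquiv.symm R * g, ?_⟩
  rw [AffGr.rotate_mul]
  have hR : Unitary.linearIsometryEquiv (Unitary.linearIsometryEquiv.symm R) = R :=
    Unitary.linearIsometryEquiv.apply_symm_apply R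
  refine AffGr.ext (Gr.ext ?_) ?_
  · change Submodule.map (Unitary.linearIsometryEquiv
      (Unitary.linearIsometryEquiv.symm R)).toLinearEquiv.toLinearMap σ'.gr.carrier = _
    rw [hR, hgr]
    ext x
    constructor
    · rintro ⟨y, hy, rfl⟩
      change R y ∈ _
      rwa [hfix y hy]
    · intro hx
      exact ⟨x, hx, hfix x hx⟩
  · change Unitary.linearIsometryEquiv (Unitary.linearIsometryEquiv.symm R) σ'.foot = _
    rw [hR]
    exact Submodule.reflection_sub hn

/-- Changing the base point of an orbit is a right translation in the group. -/
lemma lintegral_haarO_orbit {k : ℕ} (F : Gr V k → ℝ≥0∞) (η η' : Gr V k) :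
    ∫⁻ g, F (Gr.rotate g η) ∂haarO V = ∫⁻ g, F (Gr.rotate g η') ∂haarO V := by
  obtain ⟨h, hh⟩ := Gr.surjective_rotate η' η
  have hh' : Gr.rotate h η' = η := hh
  simp_rw [← hh', ← Gr.rotate_mul]
  exact lintegral_mul_right_eq_self (fun g => F (Gr.rotate g η')) h

lemma AffGr.lintegral_haarO_orbit {k : ℕ} (F : AffGr V k → ℝ≥0∞) {σ τ : AffGr V k}
    (h : σ.absDist = τ.absDist) :
    ∫⁻ g, F (AffGr.rotate g σ) ∂haarO V = ∫⁻ g, F (AffGr.rotate g τ) ∂haarO V := by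
  obtain ⟨h, hh⟩ := AffGr.exists_rotate_eq h.symm
  simp_rw [← hh, ← AffGr.rotate_mul]
  exact lintegral_mul_right_eq_self (fun g => F (AffGr.rotate g τ)) h

lemma Gr.invariantMeasure_eq_map {k : ℕ} (η : Gr V k) :
    Gr.invariantMeasure V k = (haarO V).map (fun g => Gr.rotate g η) := by
  have h : Nonempty (Gr V k) := ⟨η⟩
  rw [Gr.invariantMeasure, dif_pos h]
  refine Measure.ext_of_lintegral _ fun F hF => ?_
  rw [lintegral_map hF (Gr.continuous_rotate _).measurable,
    lintegral_map hF (Gr.continuous_rotate _).measurable]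
  exact KPlane.lintegral_haarO_orbit F _ _

/-- Uniqueness of the invariant probability measure on the Grassmannian. -/
lemma Gr.eq_invariantMeasure {k : ℕ} (m : Measure (Gr V k)) [IsProbabilityMeasure m]
    (hm : ∀ g, m.map (Gr.rotate g) = m) : m = Gr.invariantMeasure V k := by
  obtain ⟨η⟩ := m.nonempty_of_neZero
  have hc : ∀ g : unitary (V →L[ℝ] V), Measurable (Gr.rotate g : Gr V k → Gr V k) := fun g =>
    (Gr.continuous_rotate_uncurry.comp (Continuous.prodMk_right g)).measurable
  refine Measure.ext_of_lintegral _ fun F hF => ?_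
  -- Average over the group and exchange the integrals: the inner integral becomes an orbit average,
  -- independent of `ξ`.
  calc ∫⁻ ξ, F ξ ∂m = ∫⁻ _ : unitary (V →L[ℝ] V), ∫⁻ ξ, F ξ ∂m ∂haarO V := by simp
    _ = ∫⁻ g, ∫⁻ ξ, F (Gr.rotate g ξ) ∂m ∂haarO V := by
      refine lintegral_congr fun g => ?_
      conv_lhs => rw [← hm g, lintegral_map hF (hc g)]
    _ = ∫⁻ ξ, ∫⁻ g, F (Gr.rotate g ξ) ∂haarO V ∂m :=
      lintegral_lintegral_swap (hF.comp Gr.continuous_rotate_uncurry.measurable).aemeasurable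
    _ = ∫⁻ _, ∫⁻ g, F (Gr.rotate g η) ∂haarO V ∂m :=
      lintegral_congr fun ξ => KPlane.lintegral_haarO_orbit F ξ η
    _ = ∫⁻ ξ, F ξ ∂Gr.invariantMeasure V k := by
      rw [Gr.invariantMeasure_eq_map η, lintegral_map hF (Gr.continuous_rotate _).measurable]
      simp

lemma Gr.map_invariantMeasure (k : ℕ) (e : V ≃ₗᵢ[ℝ] W) :
    (Gr.invariantMeasure V k).map (Gr.map e) = Gr.invariantMeasure W k := by
  have hm := (Gr.continuous_map (k := k) e).measurable
  by_cases h : Nonempty (Gr V k)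
  swap
  · have h' : ¬ Nonempty (Gr W k) := fun ⟨ξ⟩ => h ⟨Gr.map e.symm ξ⟩
    simp [Gr.invariantMeasure, h, h']
  have : IsProbabilityMeasure ((Gr.invariantMeasure V k).map (Gr.map e)) :=
    Measure.isProbabilityMeasure_map hm.aemeasurable
  refine Gr.eq_invariantMeasure _ fun g => ?_
  have hc : Measurable (Gr.rotate g : Gr W k → Gr W k) :=
    (Gr.continuous_rotate_uncurry.comp (Continuous.prodMk_right g)).measurable
  -- Conjugating by `e` turns a rotation of `W` into one of `V`, so the pushforward inherits
  -- invariance.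
  let g' : unitary (V →L[ℝ] V) := Unitary.linearIsometryEquiv.symm
    ((e.trans (Unitary.linearIsometryEquiv g)).trans e.symm)
  have hc' : Measurable (Gr.rotate g' : Gr V k → Gr V k) :=
    (Gr.continuous_rotate_uncurry.comp (Continuous.prodMk_right g')).measurable
  have hcomp : (Gr.rotate g : Gr W k → Gr W k) ∘ Gr.map e = Gr.map e ∘ Gr.rotate g' := by
    have hg' : Unitary.linearIsometryEquiv g' =
        ((e.trans (Unitary.linearIsometryEquiv g)).trans e.symm) :=
      Unitary.linearIsometryEquiv.apply_symm_apply _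
    funext ξ
    refine Gr.ext ?_
    change Submodule.map _ (Submodule.map _ _) = Submodule.map _ (Submodule.map _ _)
    rw [hg', ← Submodule.map_comp, ← Submodule.map_comp]
    congr 1
    ext x
    simp
  rw [Measure.map_map hc hm, hcomp, ← Measure.map_map hm hc', Gr.map_rotate_invariantMeasure]

end Map

/-! ### The measure on affine planes -/

section Measures

variable {V W : Type*} [NormedAddCommGroup V] [InnerProductSpace ℝ V] [FiniteDimensional ℝ V]
  [NormedAddCommGroup W] [InnerProductSpace ℝ W] [FiniteDimensional ℝ W]
  [MeasurableSpace V] [BorelSpace V] [MeasurableSpace W] [BorelSpace W]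

lemma AffGr.measurable_gr {k : ℕ} : Measurable (AffGr.gr : AffGr V k → Gr V k) :=
  measurable_fst.comp (comap_measurable _)

lemma AffGr.measurable_foot {k : ℕ} : Measurable (AffGr.foot : AffGr V k → V) :=
  measurable_snd.comp (comap_measurable _)

lemma AffGr.measurable_iff {α : Type*} [MeasurableSpace α] {k : ℕ} {F : α → AffGr V k} :
    Measurable F ↔ Measurable (fun a => (F a).gr) ∧ Measurable (fun a => (F a).foot) :=
  measurable_comap_iff.trans
    ⟨fun h => ⟨measurable_fst.comp h, measurable_snd.comp h⟩, fun h => h.1.prodMk h.2⟩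

@[fun_prop]
lemma AffGr.measurable_absDist {k : ℕ} : Measurable (AffGr.absDist : AffGr V k → ℝ) := by
  have : (AffGr.absDist : AffGr V k → ℝ) = fun τ => ‖τ.foot‖ := funext AffGr.absDist_eq
  rw [this]
  exact AffGr.measurable_foot.norm

lemma AffGr.measurable_map {k : ℕ} (e : V ≃ₗᵢ[ℝ] W) :
    Measurable (AffGr.map e : AffGr V k → AffGr W k) :=
  AffGr.measurable_iff.2 ⟨(Gr.continuous_map e).measurable.comp AffGr.measurable_gr,
    e.continuous.measurable.comp AffGr.measurable_foot⟩

lemma AffGr.measurable_rotate_uncurry {k : ℕ} :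
    Measurable (fun q : unitary (V →L[ℝ] V) × AffGr V k => AffGr.rotate q.1 q.2) := by
  refine AffGr.measurable_iff.2 ⟨?_, ?_⟩
  · exact Gr.continuous_rotate_uncurry.measurable.comp
      (measurable_fst.prodMk (AffGr.measurable_gr.comp measurable_snd))
  · have : Continuous (fun q : unitary (V →L[ℝ] V) × V => (q.1 : V →L[ℝ] V) q.2) :=
      (continuous_subtype_val.comp continuous_fst).clm_apply continuous_snd
    exact this.measurable.comp (measurable_fst.prodMk (AffGr.measurable_foot.comp measurable_snd))

lemma Gr.lintegral_orthogonal_map {k : ℕ} (e : V ≃ₗᵢ[ℝ] W) (ξ : Gr V k) {φ : AffGr W k → ℝ≥0∞}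
    (hφ : Measurable φ) :
    ∫⁻ u : ξ.carrierᗮ, φ (AffGr.map e ⟨ξ, u, u.2⟩) =
      ∫⁻ u : (Gr.map e ξ).carrierᗮ, φ ⟨Gr.map e ξ, u, u.2⟩ := by
  let L : ξ.carrierᗮ →ₗᵢ[ℝ] (Gr.map e ξ).carrierᗮ :=
    { toFun := fun u => ⟨e u, Gr.map_orthogonal e ξ u.2⟩
      map_add' := fun u v => Subtype.ext (by simp)
      map_smul' := fun c u => Subtype.ext (by simp)
      norm_map' := fun u => e.norm_map u }
  have hfr : Module.finrank ℝ ξ.carrierᗮ = Module.finrank ℝ (Gr.map e ξ).carrierᗮ := by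
    have h1 := ξ.carrier.finrank_add_finrank_orthogonal
    have h2 := (Gr.map e ξ).carrier.finrank_add_finrank_orthogonal
    have h3 := ξ.finrank_carrier
    have h4 := (Gr.map e ξ).finrank_carrier
    have h5 := e.toLinearEquiv.finrank_eq
    omega
  exact (L.toLinearIsometryEquiv hfr).measurePreserving.lintegral_comp
    (hφ.comp (AffGr.measurable_mk (Gr.map e ξ)))

lemma Gr.measurable_lintegral_orthogonal {k : ℕ} {φ : AffGr V k → ℝ≥0∞} (hφ : Measurable φ) :
    Measurable fun ξ : Gr V k => ∫⁻ u : ξ.carrierᗮ, φ ⟨ξ, (u : V), u.2⟩ := by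
  have h := (Measure.measurable_lintegral hφ).comp (AffGr.measurable_fiberMeasure (V := V) k)
  convert h using 2 with ξ
  exact (lintegral_map hφ (AffGr.measurable_mk ξ)).symm

lemma AffGr.map_measure (k : ℕ) (e : V ≃ₗᵢ[ℝ] W) :
    (AffGr.measure V k).map (AffGr.map e) = AffGr.measure W k := by
  refine Measure.ext_of_lintegral _ fun φ hφ => ?_
  have h := AffGr.lintegral_measure k (hφ.comp (AffGr.measurable_map (V := V) e))
  simp only [Function.comp_apply] at h
  rw [lintegral_map hφ (AffGr.measurable_map e), h,
    AffGr.lintegral_measure k hφ, ← Gr.map_invariantMeasure k e,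
    lintegral_map (Gr.measurable_lintegral_orthogonal hφ) (Gr.continuous_map e).measurable]
  exact lintegral_congr fun ξ => Gr.lintegral_orthogonal_map e ξ hφ

lemma AffGr.lintegral_rotate {k : ℕ} (g : unitary (V →L[ℝ] V)) {φ : AffGr V k → ℝ≥0∞}
    (hφ : Measurable φ) :
    ∫⁻ τ, φ (AffGr.rotate g τ) ∂AffGr.measure V k = ∫⁻ τ, φ τ ∂AffGr.measure V k := by
  conv_rhs => rw [← AffGr.map_measure k (Unitary.linearIsometryEquiv g)]
  rw [lintegral_map hφ (AffGr.measurable_map _)]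
  rfl

/-- The parametrization of the affine planes by rotations of the planes parallel to `ξ`. -/
def AffGr.param {k : ℕ} (ξ : Gr V k) (q : unitary (V →L[ℝ] V) × ξ.carrierᗮ) : AffGr V k :=
  AffGr.rotate q.1 ⟨ξ, q.2, q.2.2⟩

lemma AffGr.measurable_param {k : ℕ} (ξ : Gr V k) : Measurable (AffGr.param ξ) :=
  AffGr.measurable_rotate_uncurry.comp
    (measurable_fst.prodMk ((AffGr.measurable_mk ξ).comp measurable_snd))

lemma AffGr.surjective_param {k : ℕ} (ξ : Gr V k) : Function.Surjective (AffGr.param ξ) := by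
  intro τ
  obtain ⟨g, hg⟩ := Gr.surjective_rotate τ.gr ξ
  have hg' : (AffGr.rotate g τ).gr = ξ := hg
  refine ⟨(g⁻¹, ⟨(AffGr.rotate g τ).foot, hg' ▸ (AffGr.rotate g τ).foot_mem⟩), ?_⟩
  have : (⟨ξ, (AffGr.rotate g τ).foot, hg' ▸ (AffGr.rotate g τ).foot_mem⟩ : AffGr V k) =
    AffGr.rotate g τ := AffGr.ext hg'.symm rfl
  rw [AffGr.param, this, ← AffGr.rotate_mul, inv_mul_cancel]
  refine AffGr.ext (Gr.ext ?_) ?_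
  · change Submodule.map _ _ = _
    rw [map_one]
    exact Submodule.map_id _
  · change (Unitary.linearIsometryEquiv (1 : unitary (V →L[ℝ] V))) τ.foot = _
    rw [map_one]; rfl

/-- Realizes the measure as the image of a product measure, which yields the s-finiteness needed for
Tonelli. -/
lemma AffGr.measure_eq_map {k : ℕ} (ξ : Gr V k) :
    AffGr.measure V k = ((haarO V).prod volume).map (AffGr.param ξ) := by
  refine Measure.ext_of_lintegral _ fun φ hφ => ?_
  have h := lintegral_prod (μ := haarO V) (ν := volume) _
    (hφ.comp (AffGr.measurable_param ξ)).aemeasurable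
  simp only [Function.comp_apply] at h
  rw [lintegral_map hφ (AffGr.measurable_param ξ), h, AffGr.lintegral_measure k hφ,
    Gr.invariantMeasure_eq_map ξ,
    lintegral_map (Gr.measurable_lintegral_orthogonal hφ) (Gr.continuous_rotate ξ).measurable]
  exact lintegral_congr fun g =>
    (Gr.lintegral_orthogonal_map (Unitary.linearIsometryEquiv g) ξ hφ).symm

instance (k : ℕ) : SFinite (AffGr.measure V k) := by
  by_cases h : Nonempty (Gr V k)
  · rw [AffGr.measure_eq_map h.some]; infer_instance
  · rw [AffGr.measure, Gr.invariantMeasure, dif_neg h, Measure.bind_zero_left]; infer_instance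

/-- Together with the surjection `AffGr.param` from a standard Borel space, this lets measurability
of functions of planes be tested after pulling back. -/
instance (k : ℕ) : MeasurableSpace.CountablySeparated (AffGr V k) := by
  have : MeasurableSpace.CountablyGenerated (AffGr V k) := MeasurableSpace.CountablyGenerated.comap _
  have : MeasurableSpace.SeparatesPoints (AffGr V k) := by
    refine ⟨fun σ τ h => ?_⟩
    have hσ : MeasurableSet ((fun τ : AffGr V k => (τ.gr, τ.foot)) ⁻¹' {(σ.gr, σ.foot)}) :=
      (comap_measurable _) (measurableSet_singleton _)
    have h' := h _ hσ rfl
    rw [Set.mem_preimage, Set.mem_singleton_iff, Prod.mk.injEq] at h'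
    exact AffGr.ext h'.1.symm h'.2.symm
  infer_instance

end Measures

/-! ### Planes inside a plane; equivariance and measurability of the transform -/

section Within

variable {V W : Type*} [NormedAddCommGroup V] [InnerProductSpace ℝ V] [FiniteDimensional ℝ V]
  [NormedAddCommGroup W] [InnerProductSpace ℝ W] [FiniteDimensional ℝ W]
  [MeasurableSpace V] [BorelSpace V] [MeasurableSpace W] [BorelSpace W]

/-- The bijection between the affine planes of isometric spaces. -/
def AffGr.mapEquiv (k : ℕ) (e : V ≃ₗᵢ[ℝ] W) : AffGr V k ≃ᵐ AffGr W k where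
  toFun := AffGr.map e
  invFun := AffGr.map e.symm
  left_inv τ := by
    refine AffGr.ext (Gr.ext ?_) (e.symm_apply_apply _)
    change Submodule.map _ (Submodule.map _ _) = _
    rw [← Submodule.map_comp]
    convert Submodule.map_id _
    ext x; simp
  right_inv τ := by
    refine AffGr.ext (Gr.ext ?_) (e.apply_symm_apply _)
    change Submodule.map _ (Submodule.map _ _) = _
    rw [← Submodule.map_comp]
    convert Submodule.map_id _
    ext x; simp
  measurable_toFun := AffGr.measurable_map e
  measurable_invFun := AffGr.measurable_map e.symm

/-- The restriction of an isometric isomorphism to the direction of a plane. -/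
def AffGr.dirEquiv {k : ℕ} (e : V ≃ₗᵢ[ℝ] W) (τ : AffGr V k) : τ.dir ≃ₗᵢ[ℝ] (τ.map e).dir :=
  e.submoduleMap τ.dir

lemma AffGr.map_within {j k : ℕ} (e : V ≃ₗᵢ[ℝ] W) (τ : AffGr V k) (ζ : AffGr τ.dir j) :
    (τ.map e).within (ζ.map (τ.dirEquiv e)) = (τ.within ζ).map e := by
  refine AffGr.ext (Gr.ext ?_) ?_
  · change Submodule.map _ (Submodule.map _ _) = Submodule.map _ (Submodule.map _ _)
    rw [← Submodule.map_comp, ← Submodule.map_comp]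
    rfl
  · exact (e.map_add _ _).symm

lemma AffGr.measurable_within_uncurry {j k : ℕ} (ξ : Gr V k) :
    Measurable fun q : ξ.carrierᗮ × AffGr ξ.carrier j =>
      AffGr.within ⟨ξ, q.1, q.1.2⟩ q.2 := by
  refine AffGr.measurable_iff.2 ⟨?_, ?_⟩
  · have hc : Continuous fun η : Gr ξ.carrier j => (⟨η.carrier.map ξ.carrier.subtype,
      (Submodule.finrank_map_subtype_eq _ _).trans η.finrank_carrier⟩ : Gr V j) := by
      rw [(Gr.isEmbedding j).continuous_iff]
      -- Projecting `V` onto a subspace of `ξ` amounts to projecting onto `ξ` and then inside `ξ`;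
      -- this depends continuously on the second projection.
      have : ((fun η : Gr V j => η.carrier.starProjection) ∘ fun η : Gr ξ.carrier j =>
          (⟨η.carrier.map ξ.carrier.subtype,
            (Submodule.finrank_map_subtype_eq _ _).trans η.finrank_carrier⟩ : Gr V j)) =
          fun η => ξ.carrier.subtypeL ∘L η.carrier.starProjection ∘L
            ξ.carrier.orthogonalProjectionOnto := by
        funext η
        ext x
        refine Submodule.eq_starProjection_of_mem_of_inner_eq_zero ?_ ?_
        · exact ⟨_, Submodule.starProjection_apply_mem _ _, rfl⟩
        · rintro _ ⟨y, hy, rfl⟩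
          have h1 := Submodule.starProjection_inner_eq_zero (ξ.carrier.orthogonalProjectionOnto x) y hy
          have h2 := Submodule.starProjection_inner_eq_zero x (y : V) y.2
          simp only [inner_sub_left, sub_eq_zero] at h1 h2 ⊢
          exact h2.trans h1
      rw [this]
      exact continuous_const.clm_comp
        ((Gr.isEmbedding (V := ξ.carrier) j).continuous.clm_comp continuous_const)
    exact hc.measurable.comp (AffGr.measurable_gr.comp measurable_snd)
  · exact (measurable_subtype_coe.comp (AffGr.measurable_foot.comp measurable_snd)).add
      (measurable_subtype_coe.comp measurable_fst)

lemma AffGr.measurable_within {j k : ℕ} (τ : AffGr V k) :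
    Measurable (τ.within : AffGr τ.dir j → AffGr V j) :=
  (AffGr.measurable_within_uncurry τ.gr).comp
    (measurable_prodMk_left (x := (⟨τ.foot, τ.foot_mem⟩ : τ.gr.carrierᗮ)))

/-- The transform of nonnegative functions, as a Lebesgue integral. -/
def lTransform {j : ℕ} (k : ℕ) (φ : AffGr V j → ℝ≥0∞) (τ : AffGr V k) : ℝ≥0∞ :=
  ∫⁻ ζ : AffGr τ.dir j, φ (τ.within ζ) ∂AffGr.measure τ.dir j

lemma AffGr.measure_dir_map {k : ℕ} (j : ℕ) (e : V ≃ₗᵢ[ℝ] W) (τ : AffGr V k) :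
    AffGr.measure (τ.map e).dir j =
      (AffGr.measure τ.dir j).map (AffGr.mapEquiv j (τ.dirEquiv e)) :=
  (AffGr.map_measure j (τ.dirEquiv e)).symm

lemma lTransform_map {j k : ℕ} (e : V ≃ₗᵢ[ℝ] W) (φ : AffGr W j → ℝ≥0∞) (τ : AffGr V k) :
    lTransform k φ (τ.map e) = lTransform k (fun σ => φ (σ.map e)) τ := by
  rw [lTransform, AffGr.measure_dir_map, lintegral_map_equiv]
  exact lintegral_congr fun ζ => congrArg φ (AffGr.map_within e τ ζ)

lemma transform_map {𝕜 : Type*} [RCLike 𝕜] {j k : ℕ} (e : V ≃ₗᵢ[ℝ] W) (f : AffGr W j → 𝕜)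
    (τ : AffGr V k) : transform k f (τ.map e) = transform k (fun σ => f (σ.map e)) τ := by
  rw [transform, AffGr.measure_dir_map, integral_map_equiv]
  exact integral_congr_ae (.of_forall fun ζ => congrArg f (AffGr.map_within e τ ζ))

lemma measurable_rotate_within {j k : ℕ} (ξ : Gr V k) :
    Measurable fun q : (unitary (V →L[ℝ] V) × ξ.carrierᗮ) × AffGr ξ.carrier j =>
      AffGr.rotate q.1.1 (AffGr.within ⟨ξ, q.1.2, q.1.2.2⟩ q.2) :=
  AffGr.measurable_rotate_uncurry.comp ((measurable_fst.comp measurable_fst).prodMk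
    ((AffGr.measurable_within_uncurry ξ).comp
      ((measurable_snd.comp measurable_fst).prodMk measurable_snd)))

/-- The domain of integration varies with `τ`. Pulling back along `AffGr.param ξ`, equivariance
replaces it by the planes of the fixed space `ξ`, leaving an ordinary parametric integral. -/
lemma measurable_lTransform {j k : ℕ} {φ : AffGr V j → ℝ≥0∞} (hφ : Measurable φ) :
    Measurable (lTransform k φ) := by
  by_cases h : Nonempty (Gr V k)
  swap
  · have : IsEmpty (AffGr V k) := ⟨fun τ => h ⟨τ.gr⟩⟩
    exact measurable_of_empty _
  obtain ⟨ξ⟩ := h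
  refine ((AffGr.measurable_param ξ).measurable_comp_iff_of_surjective
    (AffGr.surjective_param ξ)).1 ?_
  have := (hφ.comp (measurable_rotate_within (j := j) ξ)).lintegral_prod_right'
    (ν := AffGr.measure ξ.carrier j)
  convert this using 2 with q
  exact lTransform_map (Unitary.linearIsometryEquiv q.1) φ _

lemma measurable_transform {𝕜 : Type*} [RCLike 𝕜] {j k : ℕ} {f : AffGr V j → 𝕜}
    (hf : Measurable f) : Measurable (transform k f) := by
  by_cases h : Nonempty (Gr V k)
  swap
  · have : IsEmpty (AffGr V k) := ⟨fun τ => h ⟨τ.gr⟩⟩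
    exact measurable_of_empty _
  obtain ⟨ξ⟩ := h
  refine ((AffGr.measurable_param ξ).measurable_comp_iff_of_surjective
    (AffGr.surjective_param ξ)).1 ?_
  have := ((hf.comp (measurable_rotate_within (j := j) ξ)).stronglyMeasurable.integral_prod_right'
    (ν := AffGr.measure ξ.carrier j)).measurable
  convert this using 2 with q
  exact transform_map (Unitary.linearIsometryEquiv q.1) f _

end Within

/-! ### Integrals over Euclidean spaces -/

section Calculus

/-- The value of `∫ (1 + |y|²) ^ (-l / 2) dy` over a Euclidean space of dimension `d`. -/
def betaConst (d l : ℝ) : ℝ := Real.pi ^ (d / 2) * (Real.Gamma ((l - d) / 2) / Real.Gamma (l / 2))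

lemma betaConst_pos {d l : ℝ} (hd : 0 ≤ d) (h : d < l) : 0 < betaConst d l :=
  mul_pos (Real.rpow_pos_of_pos Real.pi_pos _)
    (div_pos (Real.Gamma_pos_of_pos (by linarith)) (Real.Gamma_pos_of_pos (by linarith)))

lemma lintegral_rpow_mul_exp {r b : ℝ} (hr : 0 < r) (hb : 0 < b) :
    ∫⁻ t in Set.Ioi (0 : ℝ), ENNReal.ofReal (t ^ (r - 1) * Real.exp (-(b * t))) =
      ENNReal.ofReal ((1 / b) ^ r * Real.Gamma r) := by
  have h := Real.integral_rpow_mul_exp_neg_mul_Ioi hr hb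
  have hpos : 0 < (1 / b) ^ r * Real.Gamma r :=
    mul_pos (Real.rpow_pos_of_pos (by positivity) _) (Real.Gamma_pos_of_pos hr)
  rw [← h, ofReal_integral_eq_lintegral_ofReal]
  -- Integrability comes for free: an undefined Bochner integral would be zero, while the known
  -- value is positive.
  · by_contra hi
    rw [integral_undef hi] at h
    exact hpos.ne h
  · refine (ae_restrict_iff' measurableSet_Ioi).2 (.of_forall fun t ht => ?_)
    have : (0 : ℝ) < t := ht
    positivity

variable {E : Type*} [NormedAddCommGroup E] [InnerProductSpace ℝ E] [FiniteDimensional ℝ E]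
  [MeasurableSpace E] [BorelSpace E]

lemma lintegral_gaussian {t : ℝ} (ht : 0 < t) :
    ∫⁻ y : E, ENNReal.ofReal (Real.exp (-t * ‖y‖ ^ 2)) =
      ENNReal.ofReal ((Real.pi / t) ^ ((Module.finrank ℝ E : ℝ) / 2)) := by
  have h := GaussianFourier.integral_rexp_neg_mul_sq_norm (V := E) ht
  have hpos : 0 < (Real.pi / t) ^ ((Module.finrank ℝ E : ℝ) / 2) :=
    Real.rpow_pos_of_pos (by positivity) _
  rw [← h, ofReal_integral_eq_lintegral_ofReal]
  · by_contra hi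
    rw [integral_undef hi] at h
    exact hpos.ne h
  · exact .of_forall fun y => (Real.exp_pos _).le

variable (E) in
-- Write `Γ(l/2) b^(-l/2)` as `∫ t^(l/2-1) e^(-bt) dt` with `b = ‖y‖² + a²`. Tonelli leaves a
-- Gaussian integral in `y`, then another Gamma integral in `t`.
lemma lintegral_rpow_norm_sq_add {l a : ℝ} (hl : (Module.finrank ℝ E : ℝ) < l) (ha : 0 < a) :
    ∫⁻ y : E, ENNReal.ofReal (√(‖y‖ ^ 2 + a ^ 2) ^ (-l)) =
      ENNReal.ofReal (betaConst (Module.finrank ℝ E) l * a ^ ((Module.finrank ℝ E : ℝ) - l)) := by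
  set d : ℝ := ((Module.finrank ℝ E : ℕ) : ℝ) with hd
  have hd0 : 0 ≤ d := Nat.cast_nonneg _
  have hl0 : 0 < l := hd0.trans_lt hl
  have hG : 0 < Real.Gamma (l / 2) := Real.Gamma_pos_of_pos (by linarith)
  have hG' : 0 < Real.Gamma ((l - d) / 2) := Real.Gamma_pos_of_pos (by linarith)
  have h1 : ∀ y : E, ENNReal.ofReal (Real.Gamma (l / 2)) *
      ENNReal.ofReal (√(‖y‖ ^ 2 + a ^ 2) ^ (-l)) =
      ∫⁻ t in Set.Ioi (0 : ℝ), ENNReal.ofReal (t ^ (l / 2 - 1) *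
        Real.exp (-((‖y‖ ^ 2 + a ^ 2) * t))) := by
    intro y
    have hb : 0 < ‖y‖ ^ 2 + a ^ 2 := by positivity
    rw [lintegral_rpow_mul_exp (by linarith) hb, ← ENNReal.ofReal_mul hG.le]
    congr 1
    rw [mul_comm, Real.sqrt_eq_rpow, ← Real.rpow_mul hb.le, one_div (‖y‖ ^ 2 + a ^ 2), Real.inv_rpow hb.le,
      ← Real.rpow_neg hb.le]
    congr 2; ring
  have h2 : ∫⁻ y : E, ∫⁻ t in Set.Ioi (0 : ℝ), ENNReal.ofReal (t ^ (l / 2 - 1) *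
        Real.exp (-((‖y‖ ^ 2 + a ^ 2) * t))) =
      ENNReal.ofReal (Real.pi ^ (d / 2) * ((1 / a ^ 2) ^ ((l - d) / 2) *
        Real.Gamma ((l - d) / 2))) := by
    rw [lintegral_lintegral_swap (by fun_prop),
      ENNReal.ofReal_mul (by positivity),
      ← lintegral_rpow_mul_exp (by linarith) (by positivity : 0 < a ^ 2),
      ← lintegral_const_mul _ (by fun_prop)]
    refine setLIntegral_congr_fun measurableSet_Ioi fun t ht => ?_
    have ht : 0 < t := ht
    have : ∀ y : E, ENNReal.ofReal (t ^ (l / 2 - 1) * Real.exp (-((‖y‖ ^ 2 + a ^ 2) * t))) =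
        ENNReal.ofReal (t ^ (l / 2 - 1) * Real.exp (-(a ^ 2 * t))) *
          ENNReal.ofReal (Real.exp (-t * ‖y‖ ^ 2)) := by
      intro y
      rw [← ENNReal.ofReal_mul (by positivity), mul_assoc, ← Real.exp_add]
      congr 3; ring_nf
    simp_rw [this]
    rw [lintegral_const_mul _ (by fun_prop), lintegral_gaussian ht,
      ← ENNReal.ofReal_mul (by positivity), ← ENNReal.ofReal_mul (by positivity)]
    congr 1
    rw [Real.div_rpow Real.pi_pos.le ht.le, ← hd]
    have : t ^ ((l - d) / 2 - 1) = t ^ (l / 2 - 1) / t ^ (d / 2) := by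
      rw [← Real.rpow_sub ht]; congr 1; ring
    rw [this]; ring
  have h3 : ENNReal.ofReal (Real.Gamma (l / 2)) *
      ∫⁻ y : E, ENNReal.ofReal (√(‖y‖ ^ 2 + a ^ 2) ^ (-l)) =
      ENNReal.ofReal (Real.Gamma (l / 2)) * ENNReal.ofReal (betaConst d l * a ^ (d - l)) := by
    rw [← lintegral_const_mul _ (by fun_prop)]
    simp_rw [h1]
    rw [h2, ← ENNReal.ofReal_mul hG.le]
    congr 1
    have : (1 / a ^ 2) ^ ((l - d) / 2) = a ^ (d - l) := by
      rw [one_div, Real.inv_rpow (by positivity), ← Real.rpow_natCast a 2, ← Real.rpow_mul ha.le,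
        ← Real.rpow_neg ha.le]
      congr 1; push_cast; ring
    rw [this, betaConst]
    field_simp
  exact (ENNReal.mul_right_inj (by simpa using hG) ENNReal.ofReal_ne_top).1 h3

lemma lintegral_comp_smul {b : ℝ} (hb : 0 < b) (h : E → ℝ≥0∞) :
    ∫⁻ x : E, h (b • x) = ENNReal.ofReal (b ^ (-(Module.finrank ℝ E : ℝ))) * ∫⁻ x, h x := by
  have h1 := Measure.map_addHaar_smul (volume : Measure E) hb.ne'
  have h2 : MeasurableEmbedding (fun x : E => b • x) :=
    (Homeomorph.smulOfNeZero b hb.ne').measurableEmbedding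
  rw [← h2.lintegral_map h, h1, lintegral_smul_measure, abs_of_pos (by positivity),
    Real.rpow_neg hb.le, Real.rpow_natCast]
  rfl

lemma sphereArea_pos (m : ℕ) : 0 < sphereArea m := by
  have : 0 < Real.Gamma (((m : ℝ) + 1) / 2) := Real.Gamma_pos_of_pos (by positivity)
  unfold sphereArea
  positivity

/-- The area of the sphere is the dimension times the volume of the unit ball; `Γ(x + 1) = x Γ(x)`
absorbs the dimension. -/
lemma toSphere_univ {m : ℕ} (hm : Module.finrank ℝ E = m + 1) :
    (volume : Measure E).toSphere Set.univ = ENNReal.ofReal (sphereArea m) := by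
  have : Nontrivial E := Module.nontrivial_of_finrank_pos (R := ℝ) (by omega)
  rw [Measure.toSphere_apply_univ, InnerProductSpace.volume_ball, hm, ENNReal.ofReal_one, one_pow,
    one_mul, ← ENNReal.ofReal_natCast, ← ENNReal.ofReal_mul (Nat.cast_nonneg _)]
  congr 1
  have h0 : ((m : ℝ) + 1) / 2 ≠ 0 := by positivity
  have hG : 0 < Real.Gamma (((m : ℝ) + 1) / 2) := Real.Gamma_pos_of_pos (by positivity)
  rw [sphereArea]
  push_cast
  rw [Real.Gamma_add_one h0, Real.sqrt_eq_rpow, ← Real.rpow_natCast, ← Real.rpow_mul Real.pi_pos.le]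
  have : 1 / 2 * ((m + 1 : ℕ) : ℝ) = ((m : ℝ) + 1) / 2 := by push_cast; ring
  rw [this]
  field_simp

lemma lintegral_fun_norm {m : ℕ} (hm : Module.finrank ℝ E = m + 1) {h : ℝ → ℝ≥0∞}
    (hh : Measurable h) :
    ∫⁻ x : E, h ‖x‖ = ENNReal.ofReal (sphereArea m) *
      ∫⁻ r in Set.Ioi (0 : ℝ), ENNReal.ofReal (r ^ m) * h r := by
  have : Nontrivial E := Module.nontrivial_of_finrank_pos (R := ℝ) (by omega)
  have hm' : Module.finrank ℝ E - 1 = m := by omega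
  calc ∫⁻ x : E, h ‖x‖
      = ∫⁻ x in ({0}ᶜ : Set E), h ‖x‖ := by rw [restrict_compl_singleton]
    _ = ∫⁻ x : ({0}ᶜ : Set E), h ‖(x : E)‖ ∂(volume.comap Subtype.val) :=
      (lintegral_subtype_comap (measurableSet_singleton _).compl _).symm
    _ = ∫⁻ q : Metric.sphere (0 : E) 1 × Set.Ioi (0 : ℝ), h q.2
          ∂((volume : Measure E).toSphere.prod (.volumeIoiPow (Module.finrank ℝ E - 1))) := by
      rw [← (volume : Measure E).measurePreserving_homeomorphUnitSphereProd.lintegral_comp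
        (by fun_prop)]
      simp
    _ = ENNReal.ofReal (sphereArea m) *
          ∫⁻ r : Set.Ioi (0 : ℝ), h r ∂(.volumeIoiPow (Module.finrank ℝ E - 1)) := by
      rw [lintegral_prod _ (by fun_prop)]
      simp only [lintegral_const]
      rw [toSphere_univ hm, mul_comm]
    _ = _ := by
      rw [hm', Measure.volumeIoiPow, lintegral_withDensity_eq_lintegral_mul _ (by fun_prop)
        (by fun_prop)]
      congr 1
      exact lintegral_subtype_comap measurableSet_Ioi (fun r => ENNReal.ofReal (r ^ m) * h r)

lemma ae_norm_pos (hE : 0 < Module.finrank ℝ E) : ∀ᵐ x : E, 0 < ‖x‖ := by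
  have : Nontrivial E := Module.nontrivial_of_finrank_pos (R := ℝ) hE
  filter_upwards [compl_mem_ae_iff.2 (measure_singleton (μ := (volume : Measure E)) 0)] with x hx
  exact norm_pos_iff.2 hx

variable {U V : Type*} [NormedAddCommGroup U] [InnerProductSpace ℝ U] [FiniteDimensional ℝ U]
  [MeasurableSpace U] [BorelSpace U] [NormedAddCommGroup V] [InnerProductSpace ℝ V]
  [FiniteDimensional ℝ V] [MeasurableSpace V] [BorelSpace V]

variable (U E V) in
/-- A radial integral over a product of Euclidean spaces. -/
lemma lintegral_radial_prod {m : ℕ} (hU : Module.finrank ℝ U = m + 1)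
    (hV : Module.finrank ℝ V = m + Module.finrank ℝ E + 1) {s : ℝ} (hs : -((m : ℝ) + 1) < s)
    {ψ : ℝ → ℝ≥0∞} (hψ : Measurable ψ) :
    ∫⁻ u : U, ENNReal.ofReal (‖u‖ ^ s) * ∫⁻ y : E, ψ (√(‖y‖ ^ 2 + ‖u‖ ^ 2)) =
      ENNReal.ofReal (betaConst (Module.finrank ℝ E) (s + m + 1 + Module.finrank ℝ E) *
        (sphereArea m / sphereArea (m + Module.finrank ℝ E))) *
        ∫⁻ v : V, ENNReal.ofReal (‖v‖ ^ s) * ψ ‖v‖ := by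
  set d := Module.finrank ℝ E with hd
  set l : ℝ := s + m + 1 + d with hl
  have hdl : (d : ℝ) < l := by linarith
  -- Substitute `y = ‖u‖ w`, with Jacobian `‖u‖ ^ d`.
  have step1 : ∫⁻ u : U, ENNReal.ofReal (‖u‖ ^ s) * ∫⁻ y : E, ψ (√(‖y‖ ^ 2 + ‖u‖ ^ 2)) =
      ∫⁻ u : U, ∫⁻ w : E, ENNReal.ofReal (‖u‖ ^ (s + d)) * ψ (‖u‖ * √(‖w‖ ^ 2 + 1 ^ 2)) := by
    refine lintegral_congr_ae ?_
    filter_upwards [ae_norm_pos (E := U) (by omega)] with u hu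
    have h := lintegral_comp_smul (E := E) hu (fun y => ψ (√(‖y‖ ^ 2 + ‖u‖ ^ 2)))
    have h' : ∀ w : E, ψ (√(‖‖u‖ • w‖ ^ 2 + ‖u‖ ^ 2)) = ψ (‖u‖ * √(‖w‖ ^ 2 + 1 ^ 2)) := by
      intro w
      congr 1
      rw [norm_smul, norm_norm, ← Real.sqrt_sq hu.le, ← Real.sqrt_mul (by positivity),
        Real.sqrt_sq hu.le]
      congr 1; ring
    simp_rw [h'] at h
    rw [lintegral_const_mul _ (by fun_prop), h, ← mul_assoc, ← ENNReal.ofReal_mul (by positivity),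
      ← Real.rpow_add hu, ← hd, add_neg_cancel_right]
  -- For fixed `w`, rescale `u` by `b = √(‖w‖² + 1)`: the weight gives `b ^ (-(s + d))` and the
  -- Jacobian `b ^ (-(m + 1))`, in total `b ^ (-l)`.
  have step2 : ∀ w : E, ∫⁻ u : U, ENNReal.ofReal (‖u‖ ^ (s + d)) * ψ (‖u‖ * √(‖w‖ ^ 2 + 1 ^ 2)) =
      ENNReal.ofReal (√(‖w‖ ^ 2 + 1 ^ 2) ^ (-l)) *
        ∫⁻ u : U, ENNReal.ofReal (‖u‖ ^ (s + d)) * ψ ‖u‖ := by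
    intro w
    set b := √(‖w‖ ^ 2 + 1 ^ 2)
    have hb : 0 < b := Real.sqrt_pos.2 (by positivity)
    have h := lintegral_comp_smul (E := U) hb
      (fun u => ENNReal.ofReal ((b⁻¹ * ‖u‖) ^ (s + d)) * ψ ‖u‖)
    have h1 : ∀ u : U, ENNReal.ofReal ((b⁻¹ * ‖b • u‖) ^ (s + d)) * ψ ‖b • u‖ =
        ENNReal.ofReal (‖u‖ ^ (s + d)) * ψ (‖u‖ * b) := by
      intro u
      rw [norm_smul, Real.norm_of_nonneg hb.le, inv_mul_cancel_left₀ hb.ne', mul_comm b]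
    have h2 : ∀ u : U, ENNReal.ofReal ((b⁻¹ * ‖u‖) ^ (s + d)) * ψ ‖u‖ =
        ENNReal.ofReal (b⁻¹ ^ (s + d)) * (ENNReal.ofReal (‖u‖ ^ (s + d)) * ψ ‖u‖) := by
      intro u
      rw [Real.mul_rpow (by positivity) (norm_nonneg _), ENNReal.ofReal_mul (by positivity),
        mul_assoc]
    simp_rw [h1, h2] at h
    rw [h, lintegral_const_mul _ (by fun_prop), ← mul_assoc, ← ENNReal.ofReal_mul (by positivity),
      Real.inv_rpow hb.le, ← Real.rpow_neg hb.le, ← Real.rpow_add hb, hU]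
    congr 4
    push_cast; ring
  -- In polar coordinates the extra weight `r ^ d` accounts for the `d` extra dimensions of `V`;
  -- only the sphere areas differ.
  have polar : ∫⁻ u : U, ENNReal.ofReal (‖u‖ ^ (s + d)) * ψ ‖u‖ =
      ENNReal.ofReal (sphereArea m / sphereArea (m + d)) *
        ∫⁻ v : V, ENNReal.ofReal (‖v‖ ^ s) * ψ ‖v‖ := by
    rw [lintegral_fun_norm (E := U) hU (h := fun r => ENNReal.ofReal (r ^ (s + d)) * ψ r)
      (by fun_prop), lintegral_fun_norm (E := V) hV
      (h := fun r => ENNReal.ofReal (r ^ s) * ψ r) (by fun_prop), ← mul_assoc,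
      ← ENNReal.ofReal_mul (div_nonneg (sphereArea_pos _).le (sphereArea_pos _).le),
      div_mul_cancel₀ _ (sphereArea_pos _).ne']
    congr 1
    refine setLIntegral_congr_fun measurableSet_Ioi fun r hr => ?_
    have hr : 0 < r := hr
    rw [← mul_assoc, ← mul_assoc, ← ENNReal.ofReal_mul (by positivity),
      ← ENNReal.ofReal_mul (by positivity), Real.rpow_add hr, Real.rpow_natCast, pow_add]
    congr 2; ring
  rw [step1, lintegral_lintegral_swap (by fun_prop)]
  simp_rw [step2]
  rw [lintegral_mul_const _ (by fun_prop), lintegral_rpow_norm_sq_add E hdl one_pos, polar,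
    ← mul_assoc, Real.one_rpow, mul_one, ← ENNReal.ofReal_mul (betaConst_pos (by positivity) hdl).le]

end Calculus

/-! ### Radial functions, rotation averages and the weighted integral identity -/

section Radial

variable {V : Type*} [NormedAddCommGroup V] [InnerProductSpace ℝ V] [FiniteDimensional ℝ V]
  [MeasurableSpace V] [BorelSpace V]

lemma lintegral_norm_congr {E F : Type*} [NormedAddCommGroup E] [InnerProductSpace ℝ E]
    [FiniteDimensional ℝ E] [MeasurableSpace E] [BorelSpace E] [NormedAddCommGroup F]
    [InnerProductSpace ℝ F] [FiniteDimensional ℝ F] [MeasurableSpace F] [BorelSpace F]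
    (h : Module.finrank ℝ E = Module.finrank ℝ F) {ψ : ℝ → ℝ≥0∞} (hψ : Measurable ψ) :
    ∫⁻ x : E, ψ ‖x‖ = ∫⁻ x : F, ψ ‖x‖ := by
  let e : E ≃ₗᵢ[ℝ] F := (stdOrthonormalBasis ℝ E).equiv (stdOrthonormalBasis ℝ F) (finCongr h)
  rw [← e.measurePreserving.lintegral_comp (by fun_prop)]
  simp

lemma Gr.nonempty {k : ℕ} (hk : k ≤ Module.finrank ℝ V) : Nonempty (Gr V k) := by
  obtain ⟨v, hv⟩ := exists_linearIndependent_of_le_finrank (R := ℝ) hk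
  exact ⟨⟨Submodule.span ℝ (Set.range v), by simpa using finrank_span_eq_card hv⟩⟩

lemma Gr.finrank_orthogonal {k : ℕ} (ξ : Gr V k) :
    Module.finrank ℝ ξ.carrierᗮ = Module.finrank ℝ V - k := by
  have h1 := ξ.carrier.finrank_add_finrank_orthogonal
  have h2 := ξ.finrank_carrier
  omega

/-- All fibres contribute equally, and the Grassmannian has total mass one. -/
lemma AffGr.lintegral_radial (E : Type*) [NormedAddCommGroup E] [InnerProductSpace ℝ E]
    [FiniteDimensional ℝ E] [MeasurableSpace E] [BorelSpace E] {k : ℕ}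
    (hk : k ≤ Module.finrank ℝ V) (hE : Module.finrank ℝ E = Module.finrank ℝ V - k)
    {ψ : ℝ → ℝ≥0∞} (hψ : Measurable ψ) :
    ∫⁻ τ, ψ τ.absDist ∂AffGr.measure V k = ∫⁻ u : E, ψ ‖u‖ := by
  have := Gr.nonempty hk
  rw [AffGr.lintegral_measure k (φ := fun τ => ψ τ.absDist) (by fun_prop)]
  have h : ∀ ξ : Gr V k, ∫⁻ u : ξ.carrierᗮ, ψ (⟨ξ, u, u.2⟩ : AffGr V k).absDist =
      ∫⁻ u : E, ψ ‖u‖ := by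
    intro ξ
    simp_rw [AffGr.absDist_eq]
    exact lintegral_norm_congr (ξ.finrank_orthogonal.trans hE.symm) hψ
  simp_rw [h]
  simp

lemma AffGr.absDist_within {j k : ℕ} (τ : AffGr V k) (ζ : AffGr τ.dir j) :
    (τ.within ζ).absDist = √(ζ.absDist ^ 2 + τ.absDist ^ 2) := by
  rw [AffGr.absDist_eq, AffGr.absDist_eq, AffGr.absDist_eq]
  have h0 : inner ℝ (ζ.foot : V) τ.foot = 0 := (Submodule.mem_orthogonal _ _).1 τ.foot_mem _ ζ.foot.2
  have := norm_add_sq_eq_norm_sq_add_norm_sq_real h0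
  change ‖(ζ.foot : V) + τ.foot‖ = √(‖(ζ.foot : V)‖ ^ 2 + ‖τ.foot‖ ^ 2)
  rw [pow_two, pow_two, ← this]
  exact (Real.sqrt_mul_self (norm_nonneg _)).symm

lemma AffGr.absDist_nonneg {k : ℕ} (τ : AffGr V k) : 0 ≤ τ.absDist := by
  rw [AffGr.absDist_eq]; exact norm_nonneg _

lemma AffGr.absDist_le_absDist_within {j k : ℕ} (τ : AffGr V k) (ζ : AffGr τ.dir j) :
    τ.absDist ≤ (τ.within ζ).absDist := by
  rw [AffGr.absDist_within]
  exact Real.le_sqrt_of_sq_le (by nlinarith [sq_nonneg ζ.absDist])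

lemma lTransform_radial (E : Type*) [NormedAddCommGroup E] [InnerProductSpace ℝ E]
    [FiniteDimensional ℝ E] [MeasurableSpace E] [BorelSpace E] {j k : ℕ}
    (hjk : j ≤ k) (hE : Module.finrank ℝ E = k - j)
    {ψ : ℝ → ℝ≥0∞} (hψ : Measurable ψ) (τ : AffGr V k) :
    lTransform k (fun σ : AffGr V j => ψ σ.absDist) τ =
      ∫⁻ y : E, ψ (√(‖y‖ ^ 2 + τ.absDist ^ 2)) := by
  have hk : Module.finrank ℝ τ.dir = k := τ.gr.finrank_carrier
  rw [lTransform]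
  simp_rw [AffGr.absDist_within]
  exact AffGr.lintegral_radial E (ψ := fun r => ψ (√(r ^ 2 + τ.absDist ^ 2))) (by omega) (by omega)
    (by fun_prop)

/-- Discards the planes through the origin, where the laws for real powers of `|τ|` fail. -/
lemma AffGr.ae_absDist_pos {k : ℕ} (hk : k < Module.finrank ℝ V) :
    ∀ᵐ τ ∂AffGr.measure V k, 0 < τ.absDist := by
  have h := AffGr.lintegral_radial (V := V) (EuclideanSpace ℝ (Fin (Module.finrank ℝ V - k))) hk.le
    (by simp) (ψ := Set.indicator {0} 1) (measurable_one.indicator (measurableSet_singleton _))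
  have h0 : ∫⁻ u : EuclideanSpace ℝ (Fin (Module.finrank ℝ V - k)),
      Set.indicator {0} (1 : ℝ → ℝ≥0∞) ‖u‖ = 0 := by
    rw [lintegral_eq_zero_iff (by
      exact (measurable_one.indicator (measurableSet_singleton _)).comp measurable_norm)]
    filter_upwards [ae_norm_pos (E := EuclideanSpace ℝ (Fin (Module.finrank ℝ V - k)))
      (by simp; omega)] with u hu
    simp [norm_pos_iff.1 hu]
  rw [h0, lintegral_eq_zero_iff (by
      exact (measurable_one.indicator (measurableSet_singleton _)).comp
        AffGr.measurable_absDist)] at h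
  filter_upwards [h] with τ hτ
  refine τ.absDist_nonneg.lt_of_ne fun h' => ?_
  simp [← h'] at hτ

/-- The average of a function over rotations. -/
def rotAverage {k : ℕ} (φ : AffGr V k → ℝ≥0∞) (σ : AffGr V k) : ℝ≥0∞ :=
  ∫⁻ g, φ (AffGr.rotate g σ) ∂haarO V

/-- Rotations act transitively on planes at a given distance, so the average is radial. Its profile
is read off along a ray of parallel planes, which makes it measurable. -/
lemma exists_rotAverage_eq {k : ℕ} (hk : k < Module.finrank ℝ V) {φ : AffGr V k → ℝ≥0∞}
    (hφ : Measurable φ) :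
    ∃ ψ : ℝ → ℝ≥0∞, Measurable ψ ∧ ∀ σ, rotAverage φ σ = ψ σ.absDist := by
  obtain ⟨η⟩ := Gr.nonempty hk.le
  have : Nontrivial η.carrierᗮ := Module.nontrivial_of_finrank_pos (R := ℝ) (by
    rw [η.finrank_orthogonal]; omega)
  obtain ⟨v, hv⟩ := exists_norm_eq (E := η.carrierᗮ) zero_le_one
  let T : ℝ → AffGr V k := fun r => ⟨η, (r • v : η.carrierᗮ), (r • v).2⟩
  have hT : Measurable T := (AffGr.measurable_mk η).comp (by fun_prop)
  refine ⟨fun r => rotAverage φ (T r), ?_, fun σ => AffGr.lintegral_haarO_orbit φ ?_⟩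
  · exact (hφ.comp (AffGr.measurable_rotate_uncurry.comp
      (measurable_snd.prodMk (hT.comp measurable_fst)))).lintegral_prod_right'
  · rw [AffGr.absDist_eq (T _)]
    change _ = ‖σ.absDist • v‖
    rw [norm_smul, hv, mul_one, Real.norm_of_nonneg σ.absDist_nonneg]

lemma lintegral_rotAverage {k : ℕ} (s : ℝ) {φ : AffGr V k → ℝ≥0∞} (hφ : Measurable φ) :
    ∫⁻ σ, ENNReal.ofReal (σ.absDist ^ s) * rotAverage φ σ ∂AffGr.measure V k =
      ∫⁻ σ, ENNReal.ofReal (σ.absDist ^ s) * φ σ ∂AffGr.measure V k := by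
  have hmeas : Measurable fun q : unitary (V →L[ℝ] V) × AffGr V k =>
      ENNReal.ofReal (q.2.absDist ^ s) * φ (AffGr.rotate q.1 q.2) :=
    ((AffGr.measurable_absDist.comp measurable_snd).pow_const s).ennreal_ofReal.mul
      (hφ.comp AffGr.measurable_rotate_uncurry)
  calc ∫⁻ σ, ENNReal.ofReal (σ.absDist ^ s) * rotAverage φ σ ∂AffGr.measure V k
      = ∫⁻ σ, ∫⁻ g, ENNReal.ofReal (σ.absDist ^ s) * φ (AffGr.rotate g σ)
          ∂haarO V ∂AffGr.measure V k := by
        refine lintegral_congr fun σ => ?_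
        rw [lintegral_const_mul]
        · rfl
        · exact hφ.comp (AffGr.measurable_rotate_uncurry.comp measurable_prodMk_right)
    _ = ∫⁻ g, ∫⁻ σ, ENNReal.ofReal (σ.absDist ^ s) * φ (AffGr.rotate g σ)
          ∂AffGr.measure V k ∂haarO V :=
        (lintegral_lintegral_swap hmeas.aemeasurable).symm
    _ = ∫⁻ _ : unitary (V →L[ℝ] V), ∫⁻ σ, ENNReal.ofReal (σ.absDist ^ s) * φ σ
          ∂AffGr.measure V k ∂haarO V := by
        refine lintegral_congr fun g => ?_
        have h := AffGr.lintegral_rotate g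
          (φ := fun σ => ENNReal.ofReal (σ.absDist ^ s) * φ σ) (by fun_prop)
        simpa using h
    _ = _ := by simp

lemma rotAverage_lTransform {j k : ℕ} {φ : AffGr V j → ℝ≥0∞} (hφ : Measurable φ) (τ : AffGr V k) :
    rotAverage (lTransform k φ) τ = lTransform k (rotAverage φ) τ := by
  have h : ∀ g : unitary (V →L[ℝ] V), lTransform k φ (AffGr.rotate g τ) =
      ∫⁻ ζ : AffGr τ.dir j, φ (AffGr.rotate g (τ.within ζ)) ∂AffGr.measure τ.dir j :=
    fun g => lTransform_map _ φ τ
  simp_rw [rotAverage, h]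
  exact lintegral_lintegral_swap (hφ.comp (AffGr.measurable_rotate_uncurry.comp
    (measurable_fst.prodMk ((AffGr.measurable_within τ).comp measurable_snd)))).aemeasurable

/-- Integration of the transform against a power of the distance to the origin. -/
theorem lintegral_rpow_absDist_mul_lTransform {n j k : ℕ} (hV : Module.finrank ℝ V = n) (hjk : j < k)
    (hkn : k < n) {s : ℝ} (hs : (k : ℝ) - n < s) {φ : AffGr V j → ℝ≥0∞} (hφ : Measurable φ) :
    ∫⁻ τ, ENNReal.ofReal (τ.absDist ^ s) * lTransform k φ τ ∂AffGr.measure V k =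
      ENNReal.ofReal (betaConst ((k : ℝ) - j) (s + n - j) *
        (sphereArea (n - k - 1) / sphereArea (n - j - 1))) *
        ∫⁻ σ, ENNReal.ofReal (σ.absDist ^ s) * φ σ ∂AffGr.measure V j := by
  obtain ⟨ψ, hψ, hφψ⟩ := exists_rotAverage_eq (hV ▸ hjk.trans hkn) hφ
  -- Averaging over rotations changes neither side and commutes with the transform, so `φ` may be
  -- taken radial.
  rw [← lintegral_rotAverage s (measurable_lTransform hφ), ← lintegral_rotAverage s hφ]
  simp_rw [rotAverage_lTransform hφ, funext hφψ,
    lTransform_radial (EuclideanSpace ℝ (Fin (k - j))) hjk.le (by simp) hψ]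
  obtain ⟨m, rfl⟩ : ∃ m, n = k + (m + 1) := ⟨n - k - 1, by omega⟩
  obtain ⟨d, rfl⟩ : ∃ d, k = j + d := ⟨k - j, by omega⟩
  have hmeas : Measurable fun r : ℝ => ∫⁻ y : EuclideanSpace ℝ (Fin (j + d - j)),
      ψ (√(‖y‖ ^ 2 + r ^ 2)) := by
    have : Measurable fun q : ℝ × EuclideanSpace ℝ (Fin (j + d - j)) =>
      ψ (√(‖q.2‖ ^ 2 + q.1 ^ 2)) := by fun_prop
    exact this.lintegral_prod_right'
  rw [AffGr.lintegral_radial (EuclideanSpace ℝ (Fin (m + 1))) (by omega) (by simp; omega)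
      (ψ := fun r => ENNReal.ofReal (r ^ s) * ∫⁻ y : EuclideanSpace ℝ (Fin (j + d - j)),
        ψ (√(‖y‖ ^ 2 + r ^ 2))) (by fun_prop),
    AffGr.lintegral_radial (EuclideanSpace ℝ (Fin (m + d + 1))) (by omega) (by simp; omega)
      (ψ := fun r => ENNReal.ofReal (r ^ s) * ψ r) (by fun_prop),
    lintegral_radial_prod (EuclideanSpace ℝ (Fin (j + d - j)))
      (EuclideanSpace ℝ (Fin (m + 1))) (EuclideanSpace ℝ (Fin (m + d + 1))) (m := m) (by simp)
      (by simp) (by push_cast at hs; linarith) hψ]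
  have e1 : j + d + (m + 1) - (j + d) - 1 = m := by omega
  have e2 : j + d + (m + 1) - j - 1 = m + d := by omega
  have e3 : Module.finrank ℝ (EuclideanSpace ℝ (Fin (j + d - j))) = d := by simp
  rw [e1, e2, e3]
  congr 4
  · push_cast; ring
  · push_cast; ring

/-- The integral identity with `s = 0`, admissible because `k` is less than the dimension. -/
lemma ae_lTransform_eq_zero {j k : ℕ} (hjk : j < k) (hk : k < Module.finrank ℝ V)
    {φ : AffGr V j → ℝ≥0∞} (hφ : Measurable φ) (h : φ =ᵐ[AffGr.measure V j] 0) :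
    lTransform k φ =ᵐ[AffGr.measure V k] 0 := by
  have hk' : (k : ℝ) < Module.finrank ℝ V := by exact_mod_cast hk
  have hB := lintegral_rpow_absDist_mul_lTransform (V := V) rfl hjk hk (s := 0) (by linarith) hφ
  simp only [Real.rpow_zero, ENNReal.ofReal_one, one_mul] at hB
  rw [lintegral_congr_ae h] at hB
  simp only [Pi.zero_apply, lintegral_zero, mul_zero] at hB
  exact (lintegral_eq_zero_iff (measurable_lTransform hφ)).1 hB

lemma ae_ae_within {j k : ℕ} (hjk : j < k) (hk : k < Module.finrank ℝ V) {P : AffGr V j → Prop}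
    (h : ∀ᵐ σ ∂AffGr.measure V j, P σ) :
    ∀ᵐ τ ∂AffGr.measure V k, ∀ᵐ ζ ∂AffGr.measure τ.dir j, P (τ.within ζ) := by
  obtain ⟨N, hN, hNm, hN0⟩ := exists_measurable_superset_of_null h
  have h0 : N.indicator (1 : AffGr V j → ℝ≥0∞) =ᵐ[AffGr.measure V j] 0 := by
    filter_upwards [compl_mem_ae_iff.2 hN0] with σ hσ
    simpa using hσ
  filter_upwards [ae_lTransform_eq_zero hjk hk (measurable_one.indicator hNm) h0] with τ hτ
  have hm : Measurable fun ζ : AffGr τ.dir j => N.indicator (1 : AffGr V j → ℝ≥0∞) (τ.within ζ) :=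
    (measurable_one.indicator hNm).comp (AffGr.measurable_within τ)
  rw [lTransform, Pi.zero_apply, lintegral_eq_zero_iff hm] at hτ
  filter_upwards [hτ] with ζ hζ
  by_contra hP
  have : τ.within ζ ∈ N := hN hP
  simp [this] at hζ

end Radial

/-! ### The upper bound for nonnegative functions -/

section Bound

variable {V : Type*} [NormedAddCommGroup V] [InnerProductSpace ℝ V] [FiniteDimensional ℝ V]
  [MeasurableSpace V] [BorelSpace V]

lemma lTransform_rpow {j k : ℕ} (hjk : j ≤ k) {l : ℝ} (hl : (k : ℝ) - j < l) {τ : AffGr V k}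
    (hτ : 0 < τ.absDist) :
    lTransform k (fun σ : AffGr V j => ENNReal.ofReal (σ.absDist ^ (-l))) τ =
      ENNReal.ofReal (betaConst ((k : ℝ) - j) l * τ.absDist ^ ((k : ℝ) - j - l)) := by
  have hd : ((Module.finrank ℝ (EuclideanSpace ℝ (Fin (k - j))) : ℕ) : ℝ) = (k : ℝ) - j := by
    simp [Nat.cast_sub hjk]
  rw [lTransform_radial (EuclideanSpace ℝ (Fin (k - j))) hjk (by simp)
      (ψ := fun r => ENNReal.ofReal (r ^ (-l))) (by fun_prop),
    lintegral_rpow_norm_sq_add _ (by rw [hd]; exact hl) hτ, hd]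

lemma lTransform_const_mul {j k : ℕ} (c : ℝ≥0∞) {F : AffGr V j → ℝ≥0∞} (hF : Measurable F)
    (τ : AffGr V k) : lTransform k (fun σ => c * F σ) τ = c * lTransform k F τ :=
  lintegral_const_mul c (hF.comp (AffGr.measurable_within τ))

/-- Hölder's inequality for the transform, with a power weight. -/
lemma lTransform_rpow_le {j k : ℕ} (hjk : j ≤ k) {l p : ℝ} (hp : 1 ≤ p) (hl : (k : ℝ) - j < l)
    {F : AffGr V j → ℝ≥0∞} (hF : Measurable F) {τ : AffGr V k} (hτ : 0 < τ.absDist) :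
    lTransform k F τ ^ p ≤
      ENNReal.ofReal (betaConst ((k : ℝ) - j) l * τ.absDist ^ ((k : ℝ) - j - l)) ^ (p - 1) *
        lTransform k (fun σ => ENNReal.ofReal (σ.absDist ^ (l * (p - 1))) * F σ ^ p) τ := by
  rcases hp.eq_or_lt with rfl | hp
  -- For `p = 1` the conjugate exponent is infinite; here the power `p - 1 = 0` makes both sides
  -- equal.
  · simp
  obtain hpq := Real.HolderConjugate.conjExponent hp
  set q := p.conjExponent
  have hp0 : 0 < p := by linarith
  have hpq' : p * q⁻¹ = p - 1 := by
    have := hpq.inv_add_inv_eq_one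
    field_simp at this
    rw [← div_eq_mul_inv]
    linarith
  have hpos : ∀ ζ : AffGr τ.dir j, 0 < (τ.within ζ).absDist := fun ζ =>
    hτ.trans_le (AffGr.absDist_le_absDist_within τ ζ)
  have hw := AffGr.measurable_within (j := j) τ
  have hd : Measurable fun ζ : AffGr τ.dir j => (τ.within ζ).absDist :=
    AffGr.measurable_absDist.comp hw
  have hF' : Measurable fun ζ : AffGr τ.dir j => F (τ.within ζ) := hF.comp hw
  -- Insert the weight and its inverse. Both are finite and nonzero, as every plane inside `τ` is at
  -- least as far from the origin as `τ`.
  have h1 : lTransform k F τ = ∫⁻ ζ : AffGr τ.dir j,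
      ((fun ζ => ENNReal.ofReal ((τ.within ζ).absDist ^ (l * q⁻¹)) * F (τ.within ζ)) *
        fun ζ => ENNReal.ofReal ((τ.within ζ).absDist ^ (-(l * q⁻¹))) : AffGr τ.dir j → ℝ≥0∞) ζ
      ∂AffGr.measure τ.dir j := by
    refine lintegral_congr fun ζ => ?_
    simp only [Pi.mul_apply]
    rw [mul_right_comm, ← ENNReal.ofReal_mul (Real.rpow_nonneg (hpos ζ).le _),
      ← Real.rpow_add (hpos ζ), add_neg_cancel, Real.rpow_zero, ENNReal.ofReal_one, one_mul]
  have h2 := ENNReal.lintegral_mul_le_Lp_mul_Lq (AffGr.measure τ.dir j) hpq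
    (f := fun ζ => ENNReal.ofReal ((τ.within ζ).absDist ^ (l * q⁻¹)) * F (τ.within ζ))
    (g := fun ζ => ENNReal.ofReal ((τ.within ζ).absDist ^ (-(l * q⁻¹))))
    (by fun_prop) (by fun_prop)
  rw [← h1] at h2
  have h3 : ∫⁻ ζ : AffGr τ.dir j, ENNReal.ofReal ((τ.within ζ).absDist ^ (-(l * q⁻¹))) ^ q
      ∂AffGr.measure τ.dir j =
      ENNReal.ofReal (betaConst ((k : ℝ) - j) l * τ.absDist ^ ((k : ℝ) - j - l)) := by
    rw [← lTransform_rpow hjk hl hτ]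
    refine lintegral_congr fun ζ => ?_
    rw [ENNReal.ofReal_rpow_of_nonneg (Real.rpow_nonneg (hpos ζ).le _) hpq.symm.pos.le,
      ← Real.rpow_mul (hpos ζ).le]
    have := hpq.symm.pos.ne'
    congr 2; field_simp
  have h4 : ∫⁻ ζ : AffGr τ.dir j,
      (ENNReal.ofReal ((τ.within ζ).absDist ^ (l * q⁻¹)) * F (τ.within ζ)) ^ p
      ∂AffGr.measure τ.dir j =
      lTransform k (fun σ => ENNReal.ofReal (σ.absDist ^ (l * (p - 1))) * F σ ^ p) τ := by
    refine lintegral_congr fun ζ => ?_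
    rw [ENNReal.mul_rpow_of_nonneg _ _ hp0.le,
      ENNReal.ofReal_rpow_of_nonneg (Real.rpow_nonneg (hpos ζ).le _) hp0.le,
      ← Real.rpow_mul (hpos ζ).le, ← hpq']
    congr 3; ring
  rw [h3, h4] at h2
  calc lTransform k F τ ^ p ≤ _ := ENNReal.rpow_le_rpow h2 hp0.le
    _ = _ := by
      rw [ENNReal.mul_rpow_of_nonneg _ _ hp0.le, ← ENNReal.rpow_mul, ← ENNReal.rpow_mul,
        one_div_mul_cancel hp0.ne', ENNReal.rpow_one, mul_comm, ← hpq', one_div, mul_comm q⁻¹]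

/-- The `L^p` bound of the transform of nonnegative functions, for finite `p`. -/
lemma lintegral_lTransform_rpow_le {n j k : ℕ} (hV : Module.finrank ℝ V = n) (hjk : j < k)
    (hkn : k < n) {p μ l ν : ℝ} (hp : 1 ≤ p) (hl : l = μ + ((n : ℝ) - j) * p⁻¹)
    (hkl : (k : ℝ) - j < l) (hν : ν = μ - ((k : ℝ) - j) * (1 - p⁻¹))
    {F : AffGr V j → ℝ≥0∞} (hF : Measurable F) :
    ∫⁻ τ, (ENNReal.ofReal (τ.absDist ^ ν) * lTransform k F τ) ^ p ∂AffGr.measure V k ≤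
      ENNReal.ofReal (betaConst ((k : ℝ) - j) l ^ p *
        (sphereArea (n - k - 1) / sphereArea (n - j - 1))) *
        ∫⁻ σ, (ENNReal.ofReal (σ.absDist ^ μ) * F σ) ^ p ∂AffGr.measure V j := by
  have hp0 : 0 < p := by linarith
  have hd : (0 : ℝ) ≤ (k : ℝ) - j := by
    have : (j : ℝ) < k := by exact_mod_cast hjk
    linarith
  set c := betaConst ((k : ℝ) - j) l with hc_def
  have hc : 0 < c := betaConst_pos hd hkl
  -- Chosen so that `|σ| ^ s` times the Hölder weight is `|σ| ^ (μ p)`. Then `s + n - j = l`, so the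
  -- integral identity has the same constant `c` as Hölder, and `c ^ (p - 1) * c = c ^ p`.
  set s : ℝ := μ * p - l * (p - 1) with hs
  have hsl : s + n - j = l := by rw [hs, hl]; field_simp; ring
  have hpt : ∀ᵐ τ ∂AffGr.measure V k,
      (ENNReal.ofReal (τ.absDist ^ ν) * lTransform k F τ) ^ p ≤
      ENNReal.ofReal (c ^ (p - 1)) * (ENNReal.ofReal (τ.absDist ^ s) *
        lTransform k (fun σ => ENNReal.ofReal (σ.absDist ^ (l * (p - 1))) * F σ ^ p) τ) := by
    filter_upwards [AffGr.ae_absDist_pos (V := V) (hV ▸ hkn)] with τ hτ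
    rw [ENNReal.mul_rpow_of_nonneg _ _ hp0.le]
    refine (mul_le_mul_right (lTransform_rpow_le hjk.le hp hkl hF hτ) _).trans_eq ?_
    rw [← mul_assoc, ← mul_assoc, ENNReal.ofReal_rpow_of_nonneg (by positivity) hp0.le,
      ENNReal.ofReal_rpow_of_nonneg (by positivity) (by linarith),
      ← ENNReal.ofReal_mul (by positivity), ← ENNReal.ofReal_mul (by positivity)]
    congr 2
    rw [Real.mul_rpow hc.le (by positivity), ← Real.rpow_mul hτ.le, ← Real.rpow_mul hτ.le,
      mul_left_comm, ← Real.rpow_add hτ]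
    congr 2
    rw [hs, hν]; field_simp; ring
  refine (lintegral_mono_ae hpt).trans_eq ?_
  have hG : Measurable fun σ : AffGr V j =>
      ENNReal.ofReal (σ.absDist ^ (l * (p - 1))) * F σ ^ p := by fun_prop
  have hlG := measurable_lTransform (k := k) hG
  rw [lintegral_const_mul _ (by fun_prop),
    lintegral_rpow_absDist_mul_lTransform hV hjk hkn (by linarith) hG, hsl, ← mul_assoc,
    ← ENNReal.ofReal_mul (by positivity)]
  congr 1
  · congr 1
    rw [← mul_assoc]
    congr 1
    rw [← hc_def, ← Real.rpow_add_one hc.ne', sub_add_cancel]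
  · refine lintegral_congr_ae ?_
    filter_upwards [AffGr.ae_absDist_pos (V := V) (hV ▸ hjk.trans hkn)] with σ hσ
    rw [← mul_assoc, ENNReal.mul_rpow_of_nonneg _ _ hp0.le,
      ENNReal.ofReal_rpow_of_nonneg (by positivity) hp0.le, ← ENNReal.ofReal_mul (by positivity),
      ← Real.rpow_add hσ, ← Real.rpow_mul hσ.le]
    congr 3; rw [hs]; ring

/-- The `L^∞` bound of the transform of nonnegative functions. -/
lemma ae_lTransform_le {j k : ℕ} (hjk : j < k) (hk : k < Module.finrank ℝ V) {μ : ℝ}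
    (hμ : (k : ℝ) - j < μ) {F : AffGr V j → ℝ≥0∞} {M : ℝ≥0∞}
    (h : ∀ᵐ σ ∂AffGr.measure V j, ENNReal.ofReal (σ.absDist ^ μ) * F σ ≤ M) :
    ∀ᵐ τ ∂AffGr.measure V k, ENNReal.ofReal (τ.absDist ^ (μ - ((k : ℝ) - j))) * lTransform k F τ ≤
      ENNReal.ofReal (betaConst ((k : ℝ) - j) μ) * M := by
  filter_upwards [ae_ae_within hjk hk h, AffGr.ae_absDist_pos hk] with τ hτ hpos
  have h1 : lTransform k F τ ≤
      M * lTransform k (fun σ : AffGr V j => ENNReal.ofReal (σ.absDist ^ (-μ))) τ := by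
    rw [← lTransform_const_mul _ (by fun_prop)]
    refine lintegral_mono_ae ?_
    filter_upwards [hτ] with ζ hζ
    have hp : 0 < (τ.within ζ).absDist := hpos.trans_le (AffGr.absDist_le_absDist_within τ ζ)
    calc F (τ.within ζ) = (ENNReal.ofReal ((τ.within ζ).absDist ^ μ) * F (τ.within ζ)) *
          ENNReal.ofReal ((τ.within ζ).absDist ^ (-μ)) := by
          rw [mul_right_comm, ← ENNReal.ofReal_mul (by positivity), ← Real.rpow_add hp,
            add_neg_cancel, Real.rpow_zero, ENNReal.ofReal_one, one_mul]
      _ ≤ _ := mul_le_mul_left hζ _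
  refine (mul_le_mul_right h1 _).trans_eq ?_
  rw [lTransform_rpow hjk.le hμ hpos, mul_left_comm, ← ENNReal.ofReal_mul (by positivity),
    mul_left_comm, ← Real.rpow_add hpos, mul_comm]
  simp

lemma eLpNorm_lTransform_le {n j k : ℕ} (hV : Module.finrank ℝ V = n) (hjk : j < k)
    (hkn : k < n) {p : ℝ≥0∞} (hp : 1 ≤ p) {μ l ν : ℝ} (hl : l = μ + ((n : ℝ) - j) * p⁻¹.toReal)
    (hkl : (k : ℝ) - j < l) (hν : ν = μ - ((k : ℝ) - j) * (1 - p⁻¹.toReal))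
    {F : AffGr V j → ℝ≥0∞} (hF : Measurable F) :
    eLpNorm (fun τ => ENNReal.ofReal (τ.absDist ^ ν) * lTransform k F τ) p (AffGr.measure V k) ≤
      ENNReal.ofReal (betaConst ((k : ℝ) - j) l *
        (sphereArea (n - k - 1) / sphereArea (n - j - 1)) ^ p⁻¹.toReal) *
        eLpNorm (fun σ => ENNReal.ofReal (σ.absDist ^ μ) * F σ) p (AffGr.measure V j) := by
  have hd : (0 : ℝ) ≤ (k : ℝ) - j := by
    have : (j : ℝ) < k := by exact_mod_cast hjk
    linarith
  have hc := betaConst_pos hd hkl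
  have hρ := div_pos (sphereArea_pos (n - k - 1)) (sphereArea_pos (n - j - 1))
  rcases eq_or_ne p ⊤ with rfl | hp'
  · simp only [ENNReal.inv_top, ENNReal.toReal_zero, mul_zero, add_zero, sub_zero, mul_one,
      Real.rpow_zero, eLpNorm_exponent_top] at hl hν ⊢
    subst hl hν
    refine essSup_le_of_ae_le _ (ae_lTransform_le hjk (hV ▸ hkn) hkl ?_)
    exact ae_le_eLpNormEssSup
  · have hp0 : p ≠ 0 := (zero_lt_one.trans_le hp).ne'
    have hp1 : 1 ≤ p.toReal := by
      simpa using (ENNReal.toReal_le_toReal ENNReal.one_ne_top hp').2 hp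
    have hp2 : 0 < p.toReal := by linarith
    rw [eLpNorm_eq_lintegral_rpow_enorm_toReal hp0 hp', eLpNorm_eq_lintegral_rpow_enorm_toReal hp0 hp']
    rw [ENNReal.toReal_inv] at hl hν ⊢
    have h := lintegral_lTransform_rpow_le hV hjk hkn hp1 hl hkl hν hF
    simp only [enorm_eq_self]
    refine (ENNReal.rpow_le_rpow h (by positivity)).trans_eq ?_
    rw [ENNReal.mul_rpow_of_nonneg _ _ (by positivity),
      ENNReal.ofReal_rpow_of_nonneg (by positivity) (by positivity),
      Real.mul_rpow (by positivity) hρ.le, ← Real.rpow_mul hc.le, mul_one_div_cancel hp2.ne',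
      Real.rpow_one, one_div]

end Bound

/-! ### Cut-off powers as test functions -/

section Sharp

variable {V : Type*} [NormedAddCommGroup V] [InnerProductSpace ℝ V] [FiniteDimensional ℝ V]
  [MeasurableSpace V] [BorelSpace V]

/-- A power of the distance to the origin, cut off near the origin. -/
def cutPower {k : ℕ} (b : ℝ) (σ : AffGr V k) : ℝ :=
  {r : ℝ | 1 < r}.indicator (fun r => r ^ (-b)) σ.absDist

lemma cutPower_nonneg {k : ℕ} (b : ℝ) (σ : AffGr V k) : 0 ≤ cutPower b σ :=
  Set.indicator_nonneg (fun r (hr : 1 < r) => Real.rpow_nonneg (by linarith) _) _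

lemma cutPower_of_lt {k : ℕ} (b : ℝ) {σ : AffGr V k} (h : 1 < σ.absDist) :
    cutPower b σ = σ.absDist ^ (-b) := Set.indicator_of_mem (s := {r : ℝ | 1 < r}) h _

lemma cutPower_of_le {k : ℕ} (b : ℝ) {σ : AffGr V k} (h : σ.absDist ≤ 1) : cutPower b σ = 0 :=
  Set.indicator_of_notMem (s := {r : ℝ | 1 < r}) (not_lt.2 h) _

lemma measurable_cutPower {k : ℕ} (b : ℝ) : Measurable (cutPower b : AffGr V k → ℝ) :=
  ((measurable_id.pow_const (-b)).indicator measurableSet_Ioi).comp AffGr.measurable_absDist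

/-- The cut-off is not felt: planes inside `τ` are no closer to the origin than `τ`. -/
lemma lTransform_cutPower {j k : ℕ} (hjk : j ≤ k) {b : ℝ} (hb : (k : ℝ) - j < b) {τ : AffGr V k}
    (hτ : 1 < τ.absDist) :
    lTransform k (fun σ : AffGr V j => ENNReal.ofReal (cutPower b σ)) τ =
      ENNReal.ofReal (betaConst ((k : ℝ) - j) b * τ.absDist ^ ((k : ℝ) - j - b)) := by
  rw [← lTransform_rpow hjk hb (by linarith)]
  refine lintegral_congr fun ζ => ?_
  simp only [cutPower_of_lt b (hτ.trans_le (AffGr.absDist_le_absDist_within τ ζ))]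

/-- In polar coordinates the radial integrand is `r ^ (-1 - δ)` on `(1, ∞)`. -/
lemma lintegral_cutPower {n k : ℕ} (hV : Module.finrank ℝ V = n) (hkn : k < n) {δ : ℝ}
    (hδ : 0 < δ) :
    ∫⁻ σ : AffGr V k, ENNReal.ofReal (cutPower ((n : ℝ) - k + δ) σ) ∂AffGr.measure V k =
      ENNReal.ofReal (sphereArea (n - k - 1) / δ) := by
  obtain ⟨m, rfl⟩ : ∃ m, n = k + (m + 1) := ⟨n - k - 1, by omega⟩
  have e1 : k + (m + 1) - k - 1 = m := by omega
  set b : ℝ := ((k + (m + 1) : ℕ) : ℝ) - k + δ with hb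
  have hb' : b = m + 1 + δ := by rw [hb]; push_cast; ring
  have hm : Measurable fun r : ℝ =>
      ENNReal.ofReal ({r : ℝ | 1 < r}.indicator (fun r => r ^ (-b)) r) :=
    ((measurable_id.pow_const (-b)).indicator measurableSet_Ioi).ennreal_ofReal
  simp only [cutPower]
  rw [AffGr.lintegral_radial (EuclideanSpace ℝ (Fin (m + 1))) (by omega) (by simp; omega) hm,
    lintegral_fun_norm (m := m) (by simp) hm, e1, div_eq_mul_inv,
    ENNReal.ofReal_mul (sphereArea_pos m).le]
  congr 1
  have h1 : ∀ r : ℝ, ENNReal.ofReal (r ^ m) *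
      ENNReal.ofReal ({r : ℝ | 1 < r}.indicator (fun r => r ^ (-b)) r) =
      (Set.Ioi (1 : ℝ)).indicator (fun r => ENNReal.ofReal (r ^ (-1 - δ))) r := by
    intro r
    by_cases hr : 1 < r
    · have hr0 : 0 < r := by linarith
      rw [Set.indicator_of_mem (s := {r : ℝ | 1 < r}) hr, Set.indicator_of_mem (s := Set.Ioi 1) hr,
        ← ENNReal.ofReal_mul (by positivity), ← Real.rpow_natCast, ← Real.rpow_add hr0, hb']
      congr 2; ring
    · rw [Set.indicator_of_notMem (s := {r : ℝ | 1 < r}) hr,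
        Set.indicator_of_notMem (s := Set.Ioi 1) hr]
      simp
  simp_rw [h1]
  rw [lintegral_indicator measurableSet_Ioi, Measure.restrict_restrict measurableSet_Ioi,
    Set.inter_eq_left.2 (Set.Ioi_subset_Ioi zero_le_one),
    ← ofReal_integral_eq_lintegral_ofReal (integrableOn_Ioi_rpow_of_lt (by linarith) one_pos),
    integral_Ioi_rpow_of_lt (by linarith) one_pos]
  · congr 1
    rw [Real.one_rpow, show (-1 - δ + 1) = -δ by ring, neg_div_neg_eq, one_div]
  · refine (ae_restrict_iff' measurableSet_Ioi).2 (.of_forall fun r hr => ?_)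
    have : (1 : ℝ) < r := hr
    have : 0 < r := by linarith
    positivity

end Sharp

/-! ### Boundedness and linearity for scalar functions -/

section Operator

variable {V : Type*} [NormedAddCommGroup V] [InnerProductSpace ℝ V] [FiniteDimensional ℝ V]
  [MeasurableSpace V] [BorelSpace V] {𝕜 : Type*} [RCLike 𝕜]

lemma enorm_coe_of_nonneg (𝕜 : Type*) [RCLike 𝕜] {r : ℝ} (hr : 0 ≤ r) :
    ‖((r : ℝ) : 𝕜)‖ₑ = ENNReal.ofReal r := by
  rw [← ofReal_norm, RCLike.norm_ofReal, abs_of_nonneg hr]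

lemma wNorm_eq {k : ℕ} (p : ℝ≥0∞) (ν : ℝ) (f : AffGr V k → 𝕜) :
    wNorm p ν f = eLpNorm (fun τ => ENNReal.ofReal (τ.absDist ^ ν) * ‖f τ‖ₑ) p
      (AffGr.measure V k) := by
  refine eLpNorm_congr_enorm_ae (.of_forall fun τ => ?_)
  rw [enorm_eq_self, enorm_mul, enorm_coe_of_nonneg 𝕜 (Real.rpow_nonneg τ.absDist_nonneg _)]

lemma wNorm_congr_ae {k : ℕ} (p : ℝ≥0∞) (ν : ℝ) {f g : AffGr V k → 𝕜}
    (h : f =ᵐ[AffGr.measure V k] g) : wNorm p ν f = wNorm p ν g :=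
  eLpNorm_congr_ae (by filter_upwards [h] with τ hτ; rw [hτ])

lemma transform_congr_ae {j k : ℕ} (hjk : j < k) (hk : k < Module.finrank ℝ V)
    {f g : AffGr V j → 𝕜} (h : f =ᵐ[AffGr.measure V j] g) :
    transform k f =ᵐ[AffGr.measure V k] transform k g := by
  filter_upwards [ae_ae_within hjk hk h] with τ hτ
  exact integral_congr_ae hτ

lemma ae_lt_top_of_eLpNorm_lt_top {α : Type*} [MeasurableSpace α] {m : Measure α} {p : ℝ≥0∞}
    (hp : p ≠ 0) {F : α → ℝ≥0∞} (hF : Measurable F) (h : eLpNorm F p m < ∞) :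
    ∀ᵐ x ∂m, F x < ∞ := by
  rcases eq_or_ne p ⊤ with rfl | hp'
  · filter_upwards [ae_le_eLpNormEssSup (f := F) (μ := m)] with x hx
    rw [eLpNorm_exponent_top] at h
    exact hx.trans_lt h
  · have h' := lintegral_rpow_enorm_lt_top_of_eLpNorm_lt_top hp hp' h
    have hpos := ENNReal.toReal_pos hp hp'
    filter_upwards [ae_lt_top (by fun_prop) h'.ne] with x hx
    exact (ENNReal.rpow_lt_top_iff_of_pos hpos).1 hx

variable {n j k : ℕ} {p : ℝ≥0∞} {μ l ν : ℝ}

lemma MemWLp.ae_transformConverges (hV : Module.finrank ℝ V = n) (hjk : j < k)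
    (hkn : k < n) (hp : 1 ≤ p) (hl : l = μ + ((n : ℝ) - j) * p⁻¹.toReal)
    (hkl : (k : ℝ) - j < l) (hν : ν = μ - ((k : ℝ) - j) * (1 - p⁻¹.toReal))
    {f : AffGr V j → 𝕜} (hf : MemWLp p μ f) :
    ∀ᵐ τ ∂AffGr.measure V k, TransformConverges f τ := by
  -- Work with a measurable representative; `ae_ae_within` transfers the conclusion back on almost
  -- every `τ`.
  set f0 := hf.1.mk f
  have hf0 : StronglyMeasurable f0 := hf.1.stronglyMeasurable_mk
  have hff : f =ᵐ[AffGr.measure V j] f0 := hf.1.ae_eq_mk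
  have hF : Measurable fun σ => ‖f0 σ‖ₑ := hf0.measurable.enorm
  have hT := measurable_lTransform (k := k) hF
  have h1 := eLpNorm_lTransform_le hV hjk hkn hp hl hkl hν hF
  rw [← wNorm_eq, ← wNorm_congr_ae p μ hff] at h1
  have h2 := ae_lt_top_of_eLpNorm_lt_top (zero_lt_one.trans_le hp).ne' (by fun_prop)
    (h1.trans_lt (ENNReal.mul_lt_top ENNReal.ofReal_lt_top hf.2))
  filter_upwards [h2, AffGr.ae_absDist_pos (V := V) (hV ▸ hkn), ae_ae_within hjk (hV ▸ hkn) hff]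
    with τ hτ hpos hae
  have h3 : ENNReal.ofReal (τ.absDist ^ ν) ≠ 0 := by simpa using Real.rpow_pos_of_pos hpos ν
  have h4 : lTransform k (fun σ => ‖f0 σ‖ₑ) τ < ∞ := by
    refine lt_top_iff_ne_top.2 fun h => ?_
    rw [h, ENNReal.mul_top h3] at hτ
    exact lt_irrefl _ hτ
  refine Integrable.congr (f := fun ζ => f0 (τ.within ζ)) ⟨?_, h4⟩ (hae.mono fun ζ h => h.symm)
  exact (hf0.comp_measurable (AffGr.measurable_within τ)).aestronglyMeasurable

lemma MemWLp.wNorm_transform_le (hV : Module.finrank ℝ V = n) (hjk : j < k)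
    (hkn : k < n) (hp : 1 ≤ p) (hl : l = μ + ((n : ℝ) - j) * p⁻¹.toReal)
    (hkl : (k : ℝ) - j < l) (hν : ν = μ - ((k : ℝ) - j) * (1 - p⁻¹.toReal))
    {f : AffGr V j → 𝕜} (hf : MemWLp p μ f) :
    wNorm p ν (transform k f) ≤ ENNReal.ofReal (betaConst ((k : ℝ) - j) l *
        (sphereArea (n - k - 1) / sphereArea (n - j - 1)) ^ p⁻¹.toReal) * wNorm p μ f := by
  set f0 := hf.1.mk f
  have hf0 : StronglyMeasurable f0 := hf.1.stronglyMeasurable_mk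
  have hff : f =ᵐ[AffGr.measure V j] f0 := hf.1.ae_eq_mk
  rw [wNorm_congr_ae p μ hff, wNorm_congr_ae p ν (transform_congr_ae hjk (hV ▸ hkn) hff), wNorm_eq,
    wNorm_eq]
  refine le_trans (eLpNorm_mono_enorm fun τ => ?_)
    (eLpNorm_lTransform_le hV hjk hkn hp hl hkl hν hf0.measurable.enorm)
  simp only [enorm_eq_self]
  exact mul_le_mul_right (enorm_integral_le_lintegral_enorm _) _

lemma MemWLp.transform (hV : Module.finrank ℝ V = n) (hjk : j < k)
    (hkn : k < n) (hp : 1 ≤ p) (hl : l = μ + ((n : ℝ) - j) * p⁻¹.toReal)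
    (hkl : (k : ℝ) - j < l) (hν : ν = μ - ((k : ℝ) - j) * (1 - p⁻¹.toReal))
    {f : AffGr V j → 𝕜} (hf : MemWLp p μ f) : MemWLp p ν (transform k f) := by
  refine ⟨?_, (hf.wNorm_transform_le hV hjk hkn hp hl hkl hν).trans_lt
    (ENNReal.mul_lt_top ENNReal.ofReal_lt_top hf.2)⟩
  exact ((measurable_transform hf.1.stronglyMeasurable_mk.measurable).aestronglyMeasurable).congr
    (transform_congr_ae hjk (hV ▸ hkn) hf.1.ae_eq_mk).symm

lemma transform_smul_add_smul {f g : AffGr V j → 𝕜} {τ : AffGr V k} (hf : TransformConverges f τ)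
    (hg : TransformConverges g τ) (a b : 𝕜) :
    KPlane.transform k (a • f + b • g) τ =
      a • KPlane.transform k f τ + b • KPlane.transform k g τ := by
  simp only [KPlane.transform, Pi.add_apply, Pi.smul_apply]
  rw [← integral_smul, ← integral_smul]
  exact integral_add (Integrable.smul a hf) (Integrable.smul b hg)

end Operator

/-! ### Optimality of the constant -/

section Sharp

variable {V : Type*} [NormedAddCommGroup V] [InnerProductSpace ℝ V] [FiniteDimensional ℝ V]
  [MeasurableSpace V] [BorelSpace V] (𝕜 : Type*) [RCLike 𝕜]

lemma enorm_cutPower {k : ℕ} (b : ℝ) (σ : AffGr V k) :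
    ‖((cutPower b σ : ℝ) : 𝕜)‖ₑ = ENNReal.ofReal (cutPower b σ) :=
  enorm_coe_of_nonneg 𝕜 (cutPower_nonneg b σ)

lemma enorm_transform_cutPower {j k : ℕ} (hjk : j ≤ k) {b : ℝ} (hb : (k : ℝ) - j < b)
    {τ : AffGr V k} (hτ : 1 < τ.absDist) :
    ‖transform k (fun σ : AffGr V j => ((cutPower b σ : ℝ) : 𝕜)) τ‖ₑ =
      ENNReal.ofReal (betaConst ((k : ℝ) - j) b * τ.absDist ^ ((k : ℝ) - j - b)) := by
  rw [← lTransform_cutPower hjk hb hτ, transform, integral_ofReal,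
    integral_eq_lintegral_of_nonneg_ae (.of_forall fun ζ => cutPower_nonneg b _)
      ((measurable_cutPower b).comp (AffGr.measurable_within τ)).aestronglyMeasurable,
    enorm_coe_of_nonneg 𝕜 ENNReal.toReal_nonneg]
  refine ENNReal.ofReal_toReal ?_
  have := lTransform_cutPower hjk hb hτ
  rw [lTransform] at this
  rw [this]
  exact ENNReal.ofReal_ne_top

lemma ofReal_rpow_mul_cutPower {k : ℕ} {P : ℝ} (hP : 0 < P) (a b : ℝ) (σ : AffGr V k) :
    (ENNReal.ofReal (σ.absDist ^ a) * ENNReal.ofReal (cutPower b σ)) ^ P =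
      ENNReal.ofReal (cutPower ((b - a) * P) σ) := by
  rcases lt_or_ge 1 σ.absDist with h | h
  · have h0 : 0 < σ.absDist := by linarith
    rw [cutPower_of_lt _ h, cutPower_of_lt _ h, ← ENNReal.ofReal_mul (by positivity),
      ← Real.rpow_add h0, ENNReal.ofReal_rpow_of_nonneg (by positivity) hP.le, ← Real.rpow_mul h0.le]
    congr 2; ring
  · rw [cutPower_of_le _ h, cutPower_of_le _ h]
    simp [hP]

lemma wNorm_cutPower {n k : ℕ} (hV : Module.finrank ℝ V = n) (hkn : k < n) {p : ℝ≥0∞}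
    (hp : 1 ≤ p) (hp' : p ≠ ⊤) {μ b ε : ℝ} (hε : 0 < ε)
    (hb : b = μ + ((n : ℝ) - k) * p⁻¹.toReal + ε) :
    wNorm p μ (fun σ : AffGr V k => ((cutPower b σ : ℝ) : 𝕜)) =
      ENNReal.ofReal (sphereArea (n - k - 1) / (ε * p.toReal)) ^ (1 / p.toReal) := by
  have hp0 : p ≠ 0 := (zero_lt_one.trans_le hp).ne'
  have hP : 0 < p.toReal := ENNReal.toReal_pos hp0 hp'
  rw [wNorm_eq, eLpNorm_eq_lintegral_rpow_enorm_toReal hp0 hp']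
  simp only [enorm_eq_self, enorm_cutPower, ofReal_rpow_mul_cutPower hP]
  have : (b - μ) * p.toReal = (n : ℝ) - k + ε * p.toReal := by
    rw [hb, ENNReal.toReal_inv]; field_simp; ring
  rw [this, lintegral_cutPower hV hkn (by positivity)]

/-- Where `|τ| > 1` the transform is a constant times `|τ| ^ (k - j - b)`, and `b - (k - j) = ν + (n
- k)/p + ε`: again a near-critical power, with the same `ε`. Where `|τ| ≤ 1` its contribution is
dropped. -/
lemma le_wNorm_transform_cutPower {n j k : ℕ} (hV : Module.finrank ℝ V = n) (hjk : j < k)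
    (hkn : k < n) {p : ℝ≥0∞} (hp : 1 ≤ p) (hp' : p ≠ ⊤) {μ ν b ε : ℝ} (hε : 0 < ε)
    (hb : b = μ + ((n : ℝ) - j) * p⁻¹.toReal + ε) (hkb : (k : ℝ) - j < b)
    (hν : ν = μ - ((k : ℝ) - j) * (1 - p⁻¹.toReal)) :
    ENNReal.ofReal (betaConst ((k : ℝ) - j) b) *
        ENNReal.ofReal (sphereArea (n - k - 1) / (ε * p.toReal)) ^ (1 / p.toReal) ≤
      wNorm p ν (transform k (fun σ : AffGr V j => ((cutPower b σ : ℝ) : 𝕜))) := by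
  have hp0 : p ≠ 0 := (zero_lt_one.trans_le hp).ne'
  have hd : (0 : ℝ) ≤ (k : ℝ) - j := by
    have : (j : ℝ) < k := by exact_mod_cast hjk
    linarith
  have hc := betaConst_pos hd hkb
  set c := betaConst ((k : ℝ) - j) b
  have h := wNorm_cutPower (V := V) 𝕜 hV hkn hp hp' (μ := ν) hε rfl
  have hc' : ENNReal.ofReal c = ‖((c : ℝ) : 𝕜)‖ₑ := (enorm_coe_of_nonneg 𝕜 hc.le).symm
  rw [← h, wNorm, hc', ← eLpNorm_const_smul]
  refine eLpNorm_mono_enorm fun τ => ?_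
  simp only [Pi.smul_apply, smul_eq_mul, enorm_mul]
  rw [mul_left_comm]
  refine mul_le_mul_right ?_ _
  rw [enorm_cutPower, ← hc']
  rcases lt_or_ge 1 τ.absDist with h | h
  · rw [enorm_transform_cutPower 𝕜 hjk.le hkb h, cutPower_of_lt _ h, ← ENNReal.ofReal_mul hc.le]
    refine le_of_eq ?_
    congr 3
    rw [hb, hν]; ring
  · rw [cutPower_of_le _ h]
    simp

lemma betaConst_continuousAt {d l : ℝ} (hd : 0 ≤ d) (hl : d < l) : ContinuousAt (betaConst d) l := by
  have hG : ∀ x : ℝ, 0 < x → ContinuousAt Real.Gamma x := fun x hx =>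
    (Real.differentiableAt_Gamma fun m => by
      have : (0 : ℝ) ≤ m := Nat.cast_nonneg m
      linarith).continuousAt
  refine continuousAt_const.mul (ContinuousAt.div ?_ ?_ ?_)
  · exact ContinuousAt.comp (f := fun l : ℝ => (l - d) / 2) (hG _ (by linarith)) (by fun_prop)
  · exact ContinuousAt.comp (f := fun l : ℝ => l / 2) (hG _ (by linarith)) (by fun_prop)
  · exact (Real.Gamma_pos_of_pos (by linarith)).ne'

lemma le_of_forall_wNorm_transform_le {n j k : ℕ} (hV : Module.finrank ℝ V = n) (hjk : j < k)
    (hkn : k < n) {p : ℝ≥0∞} (hp : 1 ≤ p) {μ l ν : ℝ}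
    (hl : l = μ + ((n : ℝ) - j) * p⁻¹.toReal) (hkl : (k : ℝ) - j < l)
    (hν : ν = μ - ((k : ℝ) - j) * (1 - p⁻¹.toReal)) {C : ℝ} (hC : 0 ≤ C)
    (h : ∀ f : AffGr V j → 𝕜, MemWLp p μ f →
      wNorm p ν (transform k f) ≤ ENNReal.ofReal C * wNorm p μ f) :
    betaConst ((k : ℝ) - j) l *
      (sphereArea (n - k - 1) / sphereArea (n - j - 1)) ^ p⁻¹.toReal ≤ C := by
  have hd : (0 : ℝ) ≤ (k : ℝ) - j := by
    have : (j : ℝ) < k := by exact_mod_cast hjk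
    linarith
  have hm : ∀ b, AEStronglyMeasurable (fun σ : AffGr V j => ((cutPower b σ : ℝ) : 𝕜))
      (AffGr.measure V j) := fun b =>
    (RCLike.measurable_ofReal.comp (measurable_cutPower b)).aestronglyMeasurable
  rcases eq_or_ne p ⊤ with rfl | hp'
  · simp only [ENNReal.inv_top, ENNReal.toReal_zero, mul_zero, add_zero, sub_zero, mul_one,
      Real.rpow_zero] at hl hν ⊢
    subst hl
    -- For `p = ∞` the critical power itself is admissible, so no `ε` is needed.
    have hw : wNorm ⊤ l (fun σ : AffGr V j => ((cutPower l σ : ℝ) : 𝕜)) ≤ 1 := by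
      rw [wNorm_eq, eLpNorm_exponent_top]
      refine essSup_le_of_ae_le _ (.of_forall fun σ => ?_)
      simp only [enorm_eq_self, enorm_cutPower]
      rcases lt_or_ge 1 σ.absDist with h | h
      · have h0 : 0 < σ.absDist := by linarith
        rw [cutPower_of_lt _ h, ← ENNReal.ofReal_mul (by positivity), ← Real.rpow_add h0]
        simp
      · rw [cutPower_of_le _ h]
        simp
    have hle := (h _ ⟨hm l, hw.trans_lt ENNReal.one_lt_top⟩).trans (mul_le_mul_right hw _)
    rw [mul_one, wNorm_eq, eLpNorm_exponent_top] at hle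
    by_contra! hlt
    -- Beyond distance one the weighted transform equals the constant, which exceeds `C`. Almost no
    -- plane could then lie there, against the positive integral of a cut-off power.
    have hae : ∀ᵐ τ ∂AffGr.measure V k, τ.absDist ≤ 1 := by
      filter_upwards [ae_le_eLpNormEssSup (μ := AffGr.measure V k)
        (f := fun τ : AffGr V k => ENNReal.ofReal (τ.absDist ^ ν) *
          ‖transform k (fun σ : AffGr V j => ((cutPower l σ : ℝ) : 𝕜)) τ‖ₑ)] with τ hτ
      by_contra! h1
      have h0 : 0 < τ.absDist := by linarith
      have h2 := hτ.trans hle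
      rw [enorm_eq_self, enorm_transform_cutPower 𝕜 hjk.le hkl h1,
        ← ENNReal.ofReal_mul (by positivity), mul_left_comm, ← Real.rpow_add h0, hν,
        ENNReal.ofReal_le_ofReal_iff hC] at h2
      simp at h2
      linarith
    have hint := lintegral_cutPower (V := V) hV hkn one_pos
    have h0 : ∫⁻ σ : AffGr V k, ENNReal.ofReal (cutPower ((n : ℝ) - k + 1) σ) ∂AffGr.measure V k
        = 0 := by
      rw [lintegral_congr_ae (g := fun _ => 0), lintegral_zero]
      filter_upwards [hae] with τ hτ
      rw [cutPower_of_le _ hτ, ENNReal.ofReal_zero]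
    rw [h0, eq_comm, ENNReal.ofReal_eq_zero, div_one] at hint
    exact absurd (sphereArea_pos (n - k - 1)) (not_lt.2 hint)
  · have hp0 : p ≠ 0 := (zero_lt_one.trans_le hp).ne'
    have hP : 0 < p.toReal := ENNReal.toReal_pos hp0 hp'
    have hk0 := sphereArea_pos (n - k - 1)
    have hj0 := sphereArea_pos (n - j - 1)
    -- Both norms contain `(ε p) ^ (-1/p)`; it cancels and leaves the ratio of sphere areas.
    -- Continuity of `betaConst` then allows `ε → 0`.
    have key : ∀ ε : ℝ, 0 < ε → betaConst ((k : ℝ) - j) (l + ε) *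
        (sphereArea (n - k - 1) / sphereArea (n - j - 1)) ^ p⁻¹.toReal ≤ C := by
      intro ε hε
      have hkb : (k : ℝ) - j < l + ε := by linarith
      have hb : l + ε = μ + ((n : ℝ) - j) * p⁻¹.toReal + ε := by rw [hl]
      have hc := betaConst_pos hd hkb
      have hw := wNorm_cutPower (V := V) 𝕜 hV (hjk.trans hkn) hp hp' hε hb
      have hmem : MemWLp p μ (fun σ : AffGr V j => ((cutPower (l + ε) σ : ℝ) : 𝕜)) :=
        ⟨hm _, by rw [hw]; exact ENNReal.rpow_lt_top_of_nonneg (by positivity) ENNReal.ofReal_ne_top⟩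
      have h1 := (le_wNorm_transform_cutPower 𝕜 hV hjk hkn hp hp' hε hb hkb hν).trans (h _ hmem)
      rw [hw, ENNReal.ofReal_rpow_of_nonneg (by positivity) (by positivity),
        ENNReal.ofReal_rpow_of_nonneg (by positivity) (by positivity),
        ← ENNReal.ofReal_mul hc.le, ← ENNReal.ofReal_mul hC,
        ENNReal.ofReal_le_ofReal_iff (by positivity), Real.div_rpow hk0.le (by positivity),
        Real.div_rpow hj0.le (by positivity), ← mul_div_assoc, ← mul_div_assoc,
        div_le_div_iff_of_pos_right (by positivity)] at h1
      rw [ENNReal.toReal_inv, ← one_div, Real.div_rpow hk0.le hj0.le, ← mul_div_assoc,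
        div_le_iff₀ (by positivity)]
      exact h1
    have hlim : Filter.Tendsto (fun ε : ℝ => betaConst ((k : ℝ) - j) (l + ε) *
        (sphereArea (n - k - 1) / sphereArea (n - j - 1)) ^ p⁻¹.toReal) (nhdsWithin 0 (Set.Ioi 0))
        (nhds (betaConst ((k : ℝ) - j) l *
          (sphereArea (n - k - 1) / sphereArea (n - j - 1)) ^ p⁻¹.toReal)) := by
      refine Filter.Tendsto.mul_const _ ((betaConst_continuousAt hd hkl).tendsto.comp ?_)
      have : Filter.Tendsto (fun ε : ℝ => l + ε) (nhds 0) (nhds (l + 0)) :=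
        (continuous_const.add continuous_id).tendsto 0
      rw [add_zero] at this
      exact this.mono_left nhdsWithin_le_nhds
    exact le_of_tendsto hlim (by filter_upwards [self_mem_nhdsWithin] with ε hε using key ε hε)

end Sharp

end KPlane

end

/-! ### The theorem -/

theorem theorem1p2 {𝕜 : Type*} [RCLike 𝕜] (n j k : ℕ) (hjk : j < k) (hkn : k < n)
    (p p' : ℝ≥0∞) (hp : 1 ≤ p) (hpp' : p⁻¹ + p'⁻¹ = 1) (μ ν : ℝ)
    (hν : ν = μ - ((k : ℝ) - j) * p'⁻¹.toReal)
    (hμ : μ > (k : ℝ) - n * p⁻¹.toReal - j * p'⁻¹.toReal) :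
    -- for `f` in `L^p_μ`, the integrals defining `R_{j,k} f` converge absolutely almost
    -- everywhere, and `R_{j,k} f` belongs to `L^p_ν`
    (∀ f : KPlane.AffGr (EuclideanSpace ℝ (Fin n)) j → 𝕜, KPlane.MemWLp p μ f →
      (∀ᵐ τ ∂KPlane.AffGr.measure (EuclideanSpace ℝ (Fin n)) k, KPlane.TransformConverges f τ) ∧
        KPlane.MemWLp p ν (KPlane.transform k f)) ∧
    -- `R_{j,k}` is well defined on classes of almost everywhere equal functions
    (∀ f g : KPlane.AffGr (EuclideanSpace ℝ (Fin n)) j → 𝕜,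
      KPlane.MemWLp p μ f → KPlane.MemWLp p μ g →
      f =ᵐ[KPlane.AffGr.measure (EuclideanSpace ℝ (Fin n)) j] g →
      KPlane.transform k f =ᵐ[KPlane.AffGr.measure (EuclideanSpace ℝ (Fin n)) k]
        KPlane.transform k g) ∧
    -- `R_{j,k}` is linear
    (∀ (a b : 𝕜) (f g : KPlane.AffGr (EuclideanSpace ℝ (Fin n)) j → 𝕜),
      KPlane.MemWLp p μ f → KPlane.MemWLp p μ g →
      KPlane.transform k (a • f + b • g) =ᵐ[KPlane.AffGr.measure (EuclideanSpace ℝ (Fin n)) k]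
        a • KPlane.transform k f + b • KPlane.transform k g) ∧
    -- `R_{j,k}` is bounded from `L^p_μ` to `L^p_ν`, and its operator norm, the least constant `C`
    -- in the norm inequality, has the stated value
    IsLeast {C : ℝ | 0 ≤ C ∧ ∀ f : KPlane.AffGr (EuclideanSpace ℝ (Fin n)) j → 𝕜,
        KPlane.MemWLp p μ f →
        KPlane.wNorm p ν (KPlane.transform k f) ≤ ENNReal.ofReal C * KPlane.wNorm p μ f}
      (Real.pi ^ (((k : ℝ) - j) / 2) *
        (KPlane.sphereArea (n - k - 1) / KPlane.sphereArea (n - j - 1)) ^ p⁻¹.toReal *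
        (Real.Gamma ((μ + n * p⁻¹.toReal - k + j * p'⁻¹.toReal) / 2) /
          Real.Gamma ((μ + n * p⁻¹.toReal - j * p⁻¹.toReal) / 2))) := by
  have hinv : p'⁻¹.toReal = 1 - p⁻¹.toReal := by
    have h1 : p⁻¹ ≠ ⊤ := ENNReal.inv_ne_top.2 (zero_lt_one.trans_le hp).ne'
    have h2 : p'⁻¹ ≠ ⊤ := fun h => by simp [h] at hpp'
    have h3 := congrArg ENNReal.toReal hpp'
    rw [ENNReal.toReal_add h1 h2, ENNReal.toReal_one] at h3
    linarith
  have hV : Module.finrank ℝ (EuclideanSpace ℝ (Fin n)) = n := by simp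
  rw [hinv] at hν hμ ⊢
  set l : ℝ := μ + ((n : ℝ) - j) * p⁻¹.toReal with hl
  have hkl : (k : ℝ) - j < l := by rw [hl]; linarith
  -- The Gamma arguments in the stated norm are `(l - (k - j)) / 2` and `l / 2`.
  have hconst : Real.pi ^ (((k : ℝ) - j) / 2) *
      (KPlane.sphereArea (n - k - 1) / KPlane.sphereArea (n - j - 1)) ^ p⁻¹.toReal *
      (Real.Gamma ((μ + n * p⁻¹.toReal - k + j * (1 - p⁻¹.toReal)) / 2) /
        Real.Gamma ((μ + n * p⁻¹.toReal - j * p⁻¹.toReal) / 2)) =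
      KPlane.betaConst ((k : ℝ) - j) l *
        (KPlane.sphereArea (n - k - 1) / KPlane.sphereArea (n - j - 1)) ^ p⁻¹.toReal := by
    rw [KPlane.betaConst, mul_right_comm]
    congr 5 <;> rw [hl] <;> ring
  have hd : (0 : ℝ) ≤ (k : ℝ) - j := by
    have : (j : ℝ) < k := by exact_mod_cast hjk
    linarith
  have hk' : k < Module.finrank ℝ (EuclideanSpace ℝ (Fin n)) := by rwa [hV]
  rw [hconst]
  refine ⟨fun f hf => ⟨hf.ae_transformConverges hV hjk hkn hp hl hkl hν,
    hf.transform hV hjk hkn hp hl hkl hν⟩,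
    fun f g _ _ hfg => KPlane.transform_congr_ae hjk hk' hfg, fun a b f g hf hg => ?_,
    ⟨⟨?_, fun f hf => hf.wNorm_transform_le hV hjk hkn hp hl hkl hν⟩,
      fun C hC => KPlane.le_of_forall_wNorm_transform_le 𝕜 hV hjk hkn hp hl hkl hν hC.1 hC.2⟩⟩
  · filter_upwards [hf.ae_transformConverges hV hjk hkn hp hl hkl hν,
      hg.ae_transformConverges hV hjk hkn hp hl hkl hν] with τ h1 h2
    exact KPlane.transform_smul_add_smul h1 h2 a b
  · exact mul_nonneg (KPlane.betaConst_pos hd hkl).le (Real.rpow_nonneg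
      (div_nonneg (KPlane.sphereArea_pos _).le (KPlane.sphereArea_pos _).le) _)
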